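/- Let $\mathbb T^2=(\mathbb R/2\pi\mathbb Z)^2$, let $\beta>0$, $\delta\ge 0$, $\epsilon>0$, and consider, for real-valued $\eta=\eta(x,y,t)$, the initial value problem $$\eta_t+\eta\,\eta_x+(\beta-1)\eta_{xx}-\eta_{yy}-\delta\Lambda^3\eta+\epsilon\Delta^2\eta=0\quad\text{on }\mathbb T^2\times(0,\infty),\qquad \eta(\cdot,\cdot,0)=\eta_0,$$ where $\widehat{\Lambda^3 u}(\xi)=|\xi|^3\hat u(\xi)$ for $\xi\in\mathbb Z^2$. A solution is a function $\eta$ with $\eta\in C([0,T];H^2(\mathbb T^2))\cap L^2(0,T;H^4(\mathbb T^2))$ for every $0<T<\infty$ that satisfies the equation in the sense of distributions and has initial value $\eta_0$. Then there is a radius $R_{\epsilon,\delta,\beta}>0$, depending only on $\epsilon,\delta,\beta$, such that for every $\eta_0\in H^2(\mathbb T^2)$ that is odd in $x$, i.e. $\eta_0(-x,y)=-\eta_0(x,y)$, the solution $\eta$ with initial datum $\eta_0$ satisfies $$\limsup_{t\to\infty}\|\eta(t)\|_{L^2(\mathbb T^2)}\le R_{\epsilon,\delta,\beta}.$$ Moreover,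 the ball of radius $R_{\epsilon,\delta,\beta}$ is absorbing in $L^2$: for every $M$ there is $T\ge 0$ (depending on $M$ and the parameters only) such that $\|\eta(t)\|_{L^2}\le R_{\epsilon,\delta,\beta}$ for all $t\ge T$ and all such solutions with $\|\eta_0\|_{L^2}\le M$. -/

import Mathlib

open MeasureTheory Filter Topology
open scoped ContDiff

noncomputable section

namespace FallingFilm

/-- The circle `ℝ / 2πℤ`, with Lebesgue measure of total mass `2π`. -/
abbrev T1 : Type := AddCircle (2 * Real.pi)

instance instFactPeriod : Fact ((0 : ℝ) < 2 * Real.pi) := ⟨Real.two_pi_pos⟩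

/-- The torus `𝕋² = [0, 2π]²` with opposite sides identified. -/
abbrev T2 : Type := T1 × T1

/-- The space of real-valued square-integrable functions on `𝕋²`, for the measure `dx dy`. -/
abbrev L2 : Type := Lp ℝ 2 (volume : Measure T2)

/-- The character `(x, y) ↦ exp (i ξ₁ x + i ξ₂ y)`. -/
def expo (ξ : ℤ × ℤ) (p : T2) : ℂ := fourier ξ.1 p.1 * fourier ξ.2 p.2

/-- The Euclidean length `|ξ|` of a frequency `ξ ∈ ℤ²`. -/
def freq (ξ : ℤ × ℤ) : ℝ := Real.sqrt ((ξ.1 : ℝ) ^ 2 + (ξ.2 : ℝ) ^ 2)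

/-- The Fourier coefficient `(2π)⁻² ∫ exp (- i ξ₁ x - i ξ₂ y) f(x, y) dx dy`. -/
def coeff (f : T2 → ℂ) (ξ : ℤ × ℤ) : ℂ :=
  (((2 * Real.pi) ^ 2)⁻¹ : ℝ) * ∫ p : T2, expo (-ξ) p * f p

/-- The square `∑ (1 + |ξ|²) ^ s |f̂(ξ)|²` of the norm of `H^s(𝕋²)`, with values in `[0, ∞]`. -/
def sobolevSq (s : ℕ) (f : L2) : ENNReal :=
  ∑' ξ : ℤ × ℤ,
    ENNReal.ofReal ((1 + freq ξ ^ 2) ^ s * ‖coeff (fun p => ((f p : ℝ) : ℂ)) ξ‖ ^ 2)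

/-- Membership in the Sobolev space `H^s(𝕋²)`. -/
def MemSobolev (s : ℕ) (f : L2) : Prop := sobolevSq s f < ⊤

/-- Odd symmetry in the first variable, `f(-x, y) = -f(x, y)`. -/
def OddInX (f : L2) : Prop := ∀ᵐ p : T2, f (-p.1, p.2) = -f p

/-- The partial derivative in `x` of a function on the torus. -/
def dx (ψ : T2 → ℂ) (p : T2) : ℂ := deriv (fun h : ℝ => ψ (p.1 + (h : T1), p.2)) 0

/-- The partial derivative in `y` of a function on the torus. -/
def dy (ψ : T2 → ℂ) (p : T2) : ℂ := deriv (fun h : ℝ => ψ (p.1, p.2 + (h : T1))) 0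

/-- The Laplacian of a function on the torus. -/
def lap (ψ : T2 → ℂ) (p : T2) : ℂ := dx (dx ψ) p + dy (dy ψ) p

/-- The operator `Λ³`, that is, the Fourier multiplier with symbol `|ξ|³`. -/
def lambdaCubed (ψ : T2 → ℂ) (p : T2) : ℂ :=
  ∑' ξ : ℤ × ℤ, ((freq ξ ^ 3 : ℝ) : ℂ) * coeff ψ ξ * expo ξ p

/-- Smooth functions on the torus: those whose periodic lift to `ℝ²` is smooth. -/
def IsTest (ψ : T2 → ℂ) : Prop :=
  ContDiff ℝ ∞ (fun q : ℝ × ℝ => ψ ((q.1 : T1), (q.2 : T1)))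

/-- The pairing with the test function `ψ` of
`-u u_x - (β - 1) u_xx + u_yy + δ Λ³ u - ε Δ² u`, all derivatives falling on `ψ`. -/
def weakRHS (β δ ε : ℝ) (u : L2) (ψ : T2 → ℂ) : ℂ :=
  ∫ p : T2,
    ((1 / 2 : ℂ) * ((u p : ℝ) : ℂ) ^ 2 * dx ψ p
      + ((u p : ℝ) : ℂ) *
        (-((β : ℂ) - 1) * dx (dx ψ) p + dy (dy ψ) p
          + (δ : ℂ) * lambdaCubed ψ p - (ε : ℂ) * lap (lap ψ) p))

/-- `η` is a solution on `[0, ∞)` of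
`η_t + η η_x + (β - 1) η_xx - η_yy - δ Λ³ η + ε Δ² η = 0` on `𝕋²` with initial datum `η₀`:
it lies in `C([0, T]; H²) ∩ L²(0, T; H⁴)` for every `T`, and the equation, integrated in time,
holds in the sense of distributions on the torus. -/
structure IsSolution (β δ ε : ℝ) (η₀ : L2) (η : ℝ → L2) : Prop where
  initial : η 0 = η₀
  mem : ∀ t : ℝ, 0 ≤ t → MemSobolev 2 (η t)
  cont : ∀ t : ℝ, 0 ≤ t →
    Tendsto (fun r : ℝ => sobolevSq 2 (η r - η t)) (𝓝[Set.Ici 0] t) (𝓝 0)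
  sqInt : ∀ T : ℝ, 0 < T → ∫⁻ t in Set.Ioc 0 T, sobolevSq 4 (η t) < ⊤
  equation : ∀ ψ : T2 → ℂ, IsTest ψ → ∀ t : ℝ, 0 ≤ t →
    (∫ p : T2, ((η t p : ℝ) : ℂ) * ψ p) - (∫ p : T2, ((η₀ p : ℝ) : ℂ) * ψ p)
      = ∫ r in (0 : ℝ)..t, weakRHS β δ ε (η r) ψ

end FallingFilm

end

/-!
The proof follows the background-flow method of Nicolaenko, Scheurer and Temam, carried out on the
Fourier coefficients `a ξ` of the solution, which satisfy `a' = σ a - (i ξ₁ / 2) (a * a)` with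
`σ = (β - 1) ξ₁² - ξ₂² + δ |ξ|³ - ε |ξ|⁴` (`rate`, `IsSolution.exists_isModeFlow`). The linear
growth rate `2 σ` is at most `K - ε |ξ|⁴`, and the convection term does no work
(`hasSum_conj_mul_fst_mul_conv`), so the energy balance alone yields only an exponentially growing
bound. To obtain decay one measures the distance to a background flow `φ(x)`: the convection term
contributes `- ∫ η² φ'` to the derivative of `‖η - φ‖²`. With `φ' = A (1 - F)`, where `F` is the
Fejér kernel of mean `1` and order `N`, this is `- A ‖η‖² + A ∫ η² F`. The first term beats `K` for
large `A`. As `F` concentrates on the line `x = 0`, where an odd function vanishes, the second term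
is at most a multiple of `(A / N) ‖∂ₓ² η‖²` (`norm_tsum_fejer_mul_conv_le`), hence is dominated by
the dissipation for large `N`. This gives `V' ≤ - V / 2 + D` for `V = ‖η - φ‖²`
(`exists_background`), with `φ` and `D` depending on the parameters only, and Grönwall's inequality
concludes.

Two points make this rigorous for the weak solutions considered. Bounds in `H²`, uniform on compact
time intervals, allow the termwise summation of the energy balances of the individual coefficients
(`energy_identity`). The odd symmetry of the datum persists because the part of `η` that is even
in `x` solves a linear equation and has zero initial value, so it vanishes by the same energy
argument (`IsModeFlow.odd`).
-/

noncomputable section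

namespace FallingFilm

open scoped ComplexConjugate

/-! ### The Fourier basis of the torus -/

theorem continuous_expo (ξ : ℤ × ℤ) : Continuous (expo ξ) := by
  unfold expo; fun_prop

theorem expo_add (ξ ζ : ℤ × ℤ) (p : T2) : expo (ξ + ζ) p = expo ξ p * expo ζ p := by
  simp only [expo, Prod.fst_add, Prod.snd_add, fourier_add]; ring

theorem expo_zero (p : T2) : expo 0 p = 1 := by
  simp [expo]

theorem expo_neg (ξ : ℤ × ℤ) (p : T2) : expo (-ξ) p = conj (expo ξ p) := by
  simp only [expo, Prod.fst_neg, Prod.snd_neg, fourier_neg, map_mul]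

theorem norm_expo (ξ : ℤ × ℤ) (p : T2) : ‖expo ξ p‖ = 1 := by
  rw [expo, norm_mul, fourier_apply, fourier_apply, Circle.norm_coe, Circle.norm_coe, one_mul]

theorem integral_fourier (n : ℤ) :
    ∫ x : T1, fourier n x = if n = 0 then ((2 * Real.pi : ℝ) : ℂ) else 0 := by
  have h := fourierCoeff_fourier (T := 2 * Real.pi) n
  have h0 := congrFun h 0
  rw [fourierCoeff, AddCircle.integral_haarAddCircle] at h0
  simp only [neg_zero, fourier_zero, one_smul] at h0
  have hpi : ((2 * Real.pi : ℝ)) ≠ 0 := Real.two_pi_pos.ne'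
  have h1 : ∫ x : T1, fourier n x = (2 * Real.pi) • (Pi.single n (1:ℂ) : ℤ → ℂ) 0 := by
    rw [← h0, smul_smul, mul_inv_cancel₀ hpi, one_smul]
  rw [h1]
  by_cases hn : n = 0
  · subst hn; simp
  · rw [if_neg hn, Pi.single_eq_of_ne (Ne.symm hn), smul_zero]

theorem integral_expo (ξ : ℤ × ℤ) :
    ∫ p : T2, expo ξ p = if ξ = 0 then (((2 * Real.pi) ^ 2 : ℝ) : ℂ) else 0 := by
  unfold expo
  rw [Measure.volume_eq_prod, integral_prod_mul (fun x : T1 => fourier ξ.1 x)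
    (fun y : T1 => fourier ξ.2 y), integral_fourier, integral_fourier]
  rcases ξ with ⟨a, b⟩
  by_cases ha : a = 0 <;> by_cases hb : b = 0 <;> simp [ha, hb, pow_two]

/-- The character `expo ξ` as a bundled continuous function. -/
def expoC (ξ : ℤ × ℤ) : C(T2, ℂ) := ⟨expo ξ, continuous_expo ξ⟩

/-- The algebra of trigonometric polynomials on `𝕋²`. -/
def trigSubalgebra : StarSubalgebra ℂ C(T2, ℂ) where
  toSubalgebra := Algebra.adjoin ℂ (Set.range expoC)
  star_mem' := by
    change Algebra.adjoin ℂ (Set.range expoC) ≤ star (Algebra.adjoin ℂ (Set.range expoC))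
    refine Algebra.adjoin_le ?_
    rintro _ ⟨n, rfl⟩
    refine Algebra.subset_adjoin ⟨-n, ?_⟩
    ext1 x
    exact expo_neg n x

theorem trigSubalgebra_coe :
    trigSubalgebra.toSubalgebra.toSubmodule = Submodule.span ℂ (Set.range expoC) := by
  apply Algebra.adjoin_eq_span_of_subset
  refine .trans (fun x ↦ Submonoid.closure_induction (fun _ ↦ id) ⟨0, ?_⟩ ?_)
    Submodule.subset_span
  · ext z
    exact expo_zero z
  · rintro _ _ _ _ ⟨m, rfl⟩ ⟨n, rfl⟩
    refine ⟨m + n, ?_⟩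
    ext z
    exact expo_add m n z

theorem trigSubalgebra_separatesPoints : trigSubalgebra.SeparatesPoints := by
  intro x y hxy
  have hinj := AddCircle.injective_toCircle (T := 2 * Real.pi) Real.two_pi_pos.ne'
  by_cases h : x.1 = y.1
  · have h2 : x.2 ≠ y.2 := fun h2 => hxy (Prod.ext h h2)
    refine ⟨_, ⟨expoC (0, 1), Algebra.subset_adjoin ⟨(0, 1), rfl⟩, rfl⟩, ?_⟩
    intro hh
    apply h2
    apply hinj
    have : expo (0, 1) x = expo (0, 1) y := hh
    exact Circle.ext (by simpa [expo, fourier_one] using this)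
  · refine ⟨_, ⟨expoC (1, 0), Algebra.subset_adjoin ⟨(1, 0), rfl⟩, rfl⟩, ?_⟩
    intro hh
    apply h
    apply hinj
    have : expo (1, 0) x = expo (1, 0) y := hh
    exact Circle.ext (by simpa [expo, fourier_one] using this)

theorem span_expoC_closure_eq_top :
    (Submodule.span ℂ (Set.range expoC)).topologicalClosure = ⊤ := by
  rw [← trigSubalgebra_coe]
  exact congr_arg (Subalgebra.toSubmodule <| StarSubalgebra.toSubalgebra ·)
    (ContinuousMap.starSubalgebra_topologicalClosure_eq_top_of_separatesPoints _
      trigSubalgebra_separatesPoints)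

/-- The character `expo ξ`, divided by `2π`, as a unit vector of `L²(𝕋², ℂ)`. -/
def expoL2 (ξ : ℤ × ℤ) : Lp ℂ 2 (volume : Measure T2) :=
  ((2 * Real.pi : ℝ) : ℂ)⁻¹ • ContinuousMap.toLp (E := ℂ) 2 volume ℂ (expoC ξ)

theorem span_expoL2_closure_eq_top :
    (Submodule.span ℂ (Set.range expoL2)).topologicalClosure = ⊤ := by
  have h : (Submodule.span ℂ (Set.range fun ξ =>
      ContinuousMap.toLp (E := ℂ) 2 (volume : Measure T2) ℂ (expoC ξ))).topologicalClosure = ⊤ := by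
    simpa only [Submodule.map_span, ContinuousLinearMap.coe_coe, ← Set.range_comp,
      Function.comp_def] using
      (ContinuousMap.toLp_denseRange ℂ (volume : Measure T2) ℂ
        (p := 2) (by simp)).topologicalClosure_map_submodule span_expoC_closure_eq_top
  rw [eq_top_iff, ← h]
  apply Submodule.topologicalClosure_mono
  rw [Submodule.span_le]
  rintro _ ⟨ξ, rfl⟩
  have : ContinuousMap.toLp (E := ℂ) 2 (volume : Measure T2) ℂ (expoC ξ)
      = ((2 * Real.pi : ℝ) : ℂ) • expoL2 ξ := by
    rw [expoL2, smul_smul, mul_inv_cancel₀, one_smul]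
    exact_mod_cast Real.two_pi_pos.ne'
  simp only [this]
  exact Submodule.smul_mem _ _ (Submodule.subset_span ⟨ξ, rfl⟩)

theorem orthonormal_expoL2 : Orthonormal ℂ expoL2 := by
  have hpi : ((2 * Real.pi : ℝ) : ℂ) ≠ 0 := by exact_mod_cast Real.two_pi_pos.ne'
  rw [orthonormal_iff_ite]
  intro m n
  simp only [expoL2, inner_smul_left, inner_smul_right, ContinuousMap.inner_toLp]
  have : ∀ x, (expoC n) x * conj ((expoC m) x) = expo (n - m) x := by
    intro x
    rw [sub_eq_add_neg, expo_add, expo_neg]; rfl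
  simp only [this, integral_expo, sub_eq_zero, eq_comm (a := n)]
  split_ifs
  · rw [map_inv₀, Complex.conj_ofReal]
    push_cast at hpi ⊢
    field_simp
  · simp

/-- The Hilbert basis of `L²(𝕋², ℂ)` formed by the normalised characters. -/
def expoBasis : HilbertBasis (ℤ × ℤ) ℂ (Lp ℂ 2 (volume : Measure T2)) :=
  HilbertBasis.mk orthonormal_expoL2 span_expoL2_closure_eq_top.ge

theorem coeFn_expoL2 (ξ : ℤ × ℤ) :
    expoL2 ξ =ᵐ[volume] fun p => ((2 * Real.pi : ℝ) : ℂ)⁻¹ * expo ξ p := by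
  filter_upwards [Lp.coeFn_smul (((2 * Real.pi : ℝ) : ℂ)⁻¹)
    (ContinuousMap.toLp (E := ℂ) 2 (volume : Measure T2) ℂ (expoC ξ)),
    ContinuousMap.coeFn_toLp (𝕜 := ℂ) (p := 2) (volume : Measure T2) (expoC ξ)] with p h1 h2
  rw [expoL2, h1, Pi.smul_apply, h2]; rfl

theorem inner_expoL2 (ξ : ℤ × ℤ) (f : Lp ℂ 2 (volume : Measure T2)) :
    inner ℂ (expoL2 ξ) f = ((2 * Real.pi : ℝ) : ℂ) * coeff f ξ := by
  have hpi : ((2 * Real.pi : ℝ) : ℂ) ≠ 0 := by exact_mod_cast Real.two_pi_pos.ne'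
  rw [L2.inner_def]
  have : ∫ p, inner ℂ (expoL2 ξ p) (f p)
      = ∫ p : T2, ((2 * Real.pi : ℝ) : ℂ)⁻¹ * (expo (-ξ) p * f p) := by
    apply integral_congr_ae
    filter_upwards [coeFn_expoL2 ξ] with p hp
    simp only [hp, RCLike.inner_apply, map_mul, map_inv₀, Complex.conj_ofReal, expo_neg]
    ring
  rw [this, integral_const_mul, coeff]
  push_cast at hpi ⊢
  field_simp

theorem coeff_congr_ae {f g : T2 → ℂ} (h : f =ᵐ[volume] g) (ξ : ℤ × ℤ) :
    coeff f ξ = coeff g ξ := by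
  unfold coeff
  congr 1
  apply integral_congr_ae
  filter_upwards [h] with p hp
  rw [hp]

/-- **Parseval's identity** on `𝕋²`. -/
theorem hasSum_coeff_mul_coeff {f g : T2 → ℂ} (hf : MemLp f 2) (hg : MemLp g 2) :
    HasSum (fun ξ => conj (coeff f ξ) * coeff g ξ)
      ((((2 * Real.pi) ^ 2)⁻¹ : ℝ) * ∫ p, conj (f p) * g p) := by
  have hpi : ((2 * Real.pi : ℝ) : ℂ) ≠ 0 := by exact_mod_cast Real.two_pi_pos.ne'
  have h := (expoBasis.hasSum_inner_mul_inner (hf.toLp f) (hg.toLp g)).mul_left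
    (((((2 * Real.pi) ^ 2)⁻¹ : ℝ)) : ℂ)
  have e : ∀ ξ, expoBasis ξ = expoL2 ξ := fun ξ => congrFun (HilbertBasis.coe_mk _ _) ξ
  have hfg : inner ℂ (hf.toLp f) (hg.toLp g) = ∫ p, conj (f p) * g p := by
    rw [L2.inner_def]
    apply integral_congr_ae
    filter_upwards [hf.coeFn_toLp, hg.coeFn_toLp] with p h1 h2
    rw [h1, h2, RCLike.inner_apply, mul_comm]
  rw [hfg] at h
  convert! h using 2 with ξ
  rw [e, ← inner_conj_symm, inner_expoL2, inner_expoL2, coeff_congr_ae hf.coeFn_toLp,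
    coeff_congr_ae hg.coeFn_toLp]
  simp only [map_mul, Complex.conj_ofReal]
  push_cast at hpi ⊢
  field_simp

/-! ### The energy identity for infinite systems of ordinary differential equations -/

/-- A series of continuous functions converging boundedly, but perhaps not uniformly, has an
integrable sum. -/
theorem intervalIntegrable_tsum_of_bdd {ι : Type*} [Countable ι] {F : ι → ℝ → ℝ} {s t C : ℝ}
    (hst : s ≤ t) (hF : ∀ i, ContinuousOn (F i) (Set.Icc s t))
    (hC : ∀ r ∈ Set.Icc s t, Summable (fun i => |F i r|) ∧ ∑' i, |F i r| ≤ C) :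
    IntervalIntegrable (fun r => ∑' i, F i r) volume s t := by
  rw [intervalIntegrable_iff_integrableOn_Icc_of_le hst]
  have hm : AEStronglyMeasurable (fun r => ∑' i, F i r) (volume.restrict (Set.Icc s t)) := by
    refine aestronglyMeasurable_of_tendsto_ae (u := (atTop : Filter (Finset ι)))
      (f := fun S r => ∑ i ∈ S, F i r) ?_ ?_
    · intro S
      exact (continuousOn_finsetSum S fun i _ => hF i).aestronglyMeasurable measurableSet_Icc
    · filter_upwards [ae_restrict_mem measurableSet_Icc] with r hr
      exact (hC r hr).1.of_abs.hasSum
  refine Integrable.of_bound hm C ?_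
  filter_upwards [ae_restrict_mem measurableSet_Icc] with r hr
  exact (norm_tsum_le_tsum_norm (f := fun i => F i r) (hC r hr).1).trans (hC r hr).2

theorem norm_sq_sub_norm_sq_eq_integral {T : ℝ} {b n : ℝ → ℂ}
    (hn : ContinuousOn n (Set.Icc 0 T))
    (hb : ∀ t ∈ Set.Icc 0 T, b t - b 0 = ∫ r in (0 : ℝ)..t, n r)
    {s t : ℝ} (hs : 0 ≤ s) (hst : s ≤ t) (ht : t ≤ T) :
    ContinuousOn b (Set.Icc 0 T) ∧
    ∫ r in s..t, 2 * inner ℝ (b r) (n r) = ‖b t‖ ^ 2 - ‖b s‖ ^ 2 := by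
  have hT : 0 ≤ T := hs.trans (hst.trans ht)
  have hni : IntervalIntegrable n volume 0 T := by
    apply ContinuousOn.intervalIntegrable; rwa [Set.uIcc_of_le hT]
  have hbc : ContinuousOn b (Set.Icc 0 T) := by
    have h := intervalIntegral.continuousOn_primitive_interval' hni Set.left_mem_uIcc
    rw [Set.uIcc_of_le hT] at h
    refine (h.const_add (b 0)).congr fun x hx => ?_
    change b x = b 0 + ∫ r in (0 : ℝ)..x, n r
    rw [← hb x hx]; ring
  have hsub : Set.Icc s t ⊆ Set.Icc 0 T := Set.Icc_subset_Icc hs ht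
  refine ⟨hbc, intervalIntegral.integral_eq_sub_of_hasDerivAt_of_le hst
    ((hbc.mono hsub).norm.pow 2) (fun x hx => ?_) ?_⟩
  · have hx0 : x ∈ Set.Ioo 0 T := ⟨hs.trans_lt hx.1, hx.2.trans_le ht⟩
    have hd : HasDerivAt b (n x) x := by
      have h1 : HasDerivAt (fun u => ∫ r in (0 : ℝ)..u, n r) (n x) x := by
        refine intervalIntegral.integral_hasDerivAt_right
          (hni.mono_set ?_) ?_ (hn.continuousAt (Icc_mem_nhds hx0.1 hx0.2))
        · rw [Set.uIcc_of_le hT, Set.uIcc_of_le hx0.1.le]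
          exact Set.Icc_subset_Icc le_rfl hx0.2.le
        · exact (hn.mono Set.Ioo_subset_Icc_self).stronglyMeasurableAtFilter isOpen_Ioo x hx0
      refine (h1.const_add (b 0)).congr_of_eventuallyEq ?_
      filter_upwards [Icc_mem_nhds hx0.1 hx0.2] with y hy
      rw [← hb y hy]; ring
    exact hd.norm_sq
  · apply ContinuousOn.intervalIntegrable
    rw [Set.uIcc_of_le hst]
    exact ((hbc.mono hsub).inner (𝕜 := ℝ) (hn.mono hsub)).const_mul 2

/-- Energy identity: if each component of `b` solves `b' = n` and `∑ ‖b i‖ ‖n i‖` is bounded in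
time, the squared `ℓ²` norm of `b` is the integral of its formal derivative. -/
theorem energy_identity {ι : Type*} [Countable ι] {T C : ℝ} {b n : ℝ → ι → ℂ}
    (hn : ∀ i, ContinuousOn (fun t => n t i) (Set.Icc 0 T))
    (hb : ∀ i, ∀ t ∈ Set.Icc 0 T, b t i - b 0 i = ∫ r in (0 : ℝ)..t, n r i)
    (hC : ∀ t ∈ Set.Icc 0 T, Summable (fun i => ‖b t i‖ * ‖n t i‖) ∧
      ∑' i, ‖b t i‖ * ‖n t i‖ ≤ C)
    (h2 : ∀ t ∈ Set.Icc 0 T, Summable (fun i => ‖b t i‖ ^ 2))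
    {s t : ℝ} (hs : 0 ≤ s) (hst : s ≤ t) (ht : t ≤ T) :
    IntervalIntegrable (fun r => ∑' i, 2 * inner ℝ (b r i) (n r i)) volume s t ∧
    ∫ r in s..t, ∑' i, 2 * inner ℝ (b r i) (n r i)
      = ∑' i, ‖b t i‖ ^ 2 - ∑' i, ‖b s i‖ ^ 2 := by
  have hsub : Set.Icc s t ⊆ Set.Icc 0 T := Set.Icc_subset_Icc hs ht
  have hbc : ∀ i, ContinuousOn (fun t => b t i) (Set.Icc s t) := fun i =>
    (norm_sq_sub_norm_sq_eq_integral (hn i) (hb i) hs hst ht).1.mono hsub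
  have hFc : ∀ i, ContinuousOn (fun r => 2 * inner ℝ (b r i) (n r i)) (Set.Icc s t) :=
    fun i => ((hbc i).inner (𝕜 := ℝ) ((hn i).mono hsub)).const_mul 2
  have hle : ∀ r i, |2 * inner ℝ (b r i) (n r i)| ≤ 2 * (‖b r i‖ * ‖n r i‖) := fun r i => by
    rw [abs_mul, abs_two]
    exact mul_le_mul_of_nonneg_left (abs_real_inner_le_norm _ _) two_pos.le
  have hFC : ∀ r ∈ Set.Icc s t, Summable (fun i => |2 * inner ℝ (b r i) (n r i)|) ∧
      ∑' i, |2 * inner ℝ (b r i) (n r i)| ≤ 2 * C := by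
    intro r hr
    obtain ⟨h1, h3⟩ := hC r (hsub hr)
    have hS : Summable (fun i => |2 * inner ℝ (b r i) (n r i)|) :=
      (h1.mul_left 2).of_nonneg_of_le (fun i => abs_nonneg _) (hle r)
    refine ⟨hS, (hS.tsum_le_tsum (hle r) (h1.mul_left 2)).trans ?_⟩
    rw [tsum_mul_left]
    linarith
  have hint := intervalIntegrable_tsum_of_bdd hst hFc hFC
  refine ⟨hint, ?_⟩
  have hsum : HasSum (fun i => ∫ r in s..t, 2 * inner ℝ (b r i) (n r i))
      (∫ r in s..t, ∑' i, 2 * inner ℝ (b r i) (n r i)) := by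
    have hmem : ∀ r, r ∈ Set.uIoc s t → r ∈ Set.Icc s t := fun r hr => by
      rw [Set.uIoc_of_le hst] at hr; exact Set.Ioc_subset_Icc_self hr
    refine intervalIntegral.hasSum_integral_of_dominated_convergence
      (fun i r => |2 * inner ℝ (b r i) (n r i)|) (fun i => ?_) (fun i => ?_) ?_ ?_ ?_
    · rw [Set.uIoc_of_le hst]
      exact ((hFc i).mono Set.Ioc_subset_Icc_self).aestronglyMeasurable measurableSet_Ioc
    · exact .of_forall fun r _ => le_rfl
    · exact .of_forall fun r hr => (hFC r (hmem r hr)).1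
    · exact intervalIntegrable_tsum_of_bdd hst (fun i => (hFc i).abs)
        (fun r hr => by simpa only [abs_abs] using hFC r hr)
    · exact .of_forall fun r hr => (hFC r (hmem r hr)).1.of_abs.hasSum
  have hd := (h2 t ⟨hs.trans hst, ht⟩).hasSum.sub (h2 s ⟨hs, hst.trans ht⟩).hasSum
  refine hsum.unique ?_
  simpa only [(norm_sq_sub_norm_sq_eq_integral (hn _) (hb _) hs hst ht).2] using hd

/-- Grönwall's inequality for the squared `ℓ²` norm, of which only an integrated energy balance is
available. -/
theorem energy_gronwall {ι : Type*} [Countable ι] {T C K D : ℝ} {b n : ℝ → ι → ℂ}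
    (hn : ∀ i, ContinuousOn (fun t => n t i) (Set.Icc 0 T))
    (hb : ∀ i, ∀ t ∈ Set.Icc 0 T, b t i - b 0 i = ∫ r in (0 : ℝ)..t, n r i)
    (hC : ∀ t ∈ Set.Icc 0 T, Summable (fun i => ‖b t i‖ * ‖n t i‖) ∧
      ∑' i, ‖b t i‖ * ‖n t i‖ ≤ C)
    (h2 : ∀ t ∈ Set.Icc 0 T, Summable (fun i => ‖b t i‖ ^ 2))
    (hK : ∀ t ∈ Set.Icc 0 T,
      ∑' i, 2 * inner ℝ (b t i) (n t i) ≤ K * ∑' i, ‖b t i‖ ^ 2 + D)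
    {t : ℝ} (ht : t ∈ Set.Icc 0 T) :
    ∑' i, ‖b t i‖ ^ 2 ≤ gronwallBound (∑' i, ‖b 0 i‖ ^ 2) K D t := by
  have hT : 0 ≤ T := ht.1.trans ht.2
  set V : ℝ → ℝ := fun t => ∑' i, ‖b t i‖ ^ 2 with hV
  set G : ℝ → ℝ := fun r => ∑' i, 2 * inner ℝ (b r i) (n r i) with hG
  have hid := fun {s t : ℝ} (hs : 0 ≤ s) (hst : s ≤ t) (ht : t ≤ T) =>
    energy_identity hn hb hC h2 hs hst ht
  have hVc : ContinuousOn V (Set.Icc 0 T) := by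
    have h := intervalIntegral.continuousOn_primitive_interval' (hid le_rfl hT le_rfl).1
      Set.left_mem_uIcc
    rw [Set.uIcc_of_le hT] at h
    refine (h.const_add (V 0)).congr fun x hx => ?_
    change V x = V 0 + _
    rw [(hid le_rfl hx.1 hx.2).2]; ring
  have h := le_gronwallBound_of_liminf_deriv_right_le (f := V) (f' := fun x => K * V x + D)
    (δ := V 0) (K := K) (ε := D) (a := 0) (b := T) hVc ?_ le_rfl (fun x _ => le_rfl) t ht
  · simpa using h
  intro x hx r hr
  -- The slope of `V` is at most the mean of `K * V + D`, which is continuous.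
  have hcw : ContinuousWithinAt (fun y => K * V y + D) (Set.Ici x) x := by
    have : ContinuousWithinAt V (Set.Icc x T) x :=
      (hVc x ⟨hx.1, hx.2.le⟩).mono (Set.Icc_subset_Icc_left hx.1)
    have h2 : ContinuousWithinAt V (Set.Ici x) x :=
      this.mono_of_mem_nhdsWithin (Icc_mem_nhdsGE hx.2)
    exact (h2.const_mul K).add_const D
  apply Eventually.frequently
  have hlt : ∀ᶠ y in 𝓝[≥] x, K * V y + D < (K * V x + D + r) / 2 :=
    hcw.eventually_lt_const (by linarith)
  obtain ⟨u, hxu, hu⟩ := (mem_nhdsGE_iff_exists_Ico_subset).1 hlt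
  have hmem : Set.Ioo x (min u T) ∈ 𝓝[>] x := Ioo_mem_nhdsGT (lt_min hxu hx.2)
  filter_upwards [hmem] with z hz
  have hzu : z < u := hz.2.trans_le (min_le_left _ _)
  have hzT : z ≤ T := (hz.2.trans_le (min_le_right _ _)).le
  obtain ⟨hi, he⟩ := hid hx.1 hz.1.le hzT
  have hle : V z - V x ≤ ∫ _ in x..z, (K * V x + D + r) / 2 := by
    rw [← he]
    refine intervalIntegral.integral_mono_on hz.1.le hi intervalIntegrable_const fun y hy => ?_
    exact (hK y ⟨hx.1.trans hy.1, hy.2.trans hzT⟩).trans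
      (le_of_lt (hu ⟨hy.1, hy.2.trans_lt hzu⟩))
  rw [intervalIntegral.integral_const, smul_eq_mul] at hle
  have hpos : 0 < z - x := sub_pos.2 hz.1
  rw [inv_mul_lt_iff₀ hpos]
  nlinarith

/-! ### Weighted sequences on the frequency lattice and their convolutions -/

/-- The weight `1 + |ξ|²`. -/
def wt (ξ : ℤ × ℤ) : ℝ := 1 + freq ξ ^ 2

/-- The sequence `a` has squared `H²` norm `∑ (1 + |ξ|²)² |a ξ|²` at most `C`. -/
def H2Le (C : ℝ) (a : ℤ × ℤ → ℂ) : Prop :=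
  Summable (fun ξ => wt ξ ^ 2 * ‖a ξ‖ ^ 2) ∧ ∑' ξ, wt ξ ^ 2 * ‖a ξ‖ ^ 2 ≤ C

/-- The convolution of two sequences on `ℤ²`. -/
def conv (a b : ℤ × ℤ → ℂ) (ξ : ℤ × ℤ) : ℂ := ∑' ζ, a ζ * b (ξ - ζ)

theorem freq_nonneg (ξ : ℤ × ℤ) : 0 ≤ freq ξ := Real.sqrt_nonneg _

theorem freq_sq (ξ : ℤ × ℤ) : freq ξ ^ 2 = (ξ.1 : ℝ) ^ 2 + (ξ.2 : ℝ) ^ 2 :=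
  Real.sq_sqrt (by positivity)

theorem fst_pow_four_le (ξ : ℤ × ℤ) : (ξ.1 : ℝ) ^ 4 ≤ freq ξ ^ 4 := by
  rw [show freq ξ ^ 4 = (freq ξ ^ 2) ^ 2 by ring, freq_sq]
  nlinarith [sq_nonneg (ξ.1 : ℝ), sq_nonneg (ξ.2 : ℝ), sq_nonneg ((ξ.2 : ℝ) ^ 2),
    mul_nonneg (sq_nonneg (ξ.1 : ℝ)) (sq_nonneg (ξ.2 : ℝ))]

theorem one_le_wt (ξ : ℤ × ℤ) : 1 ≤ wt ξ := by
  unfold wt; nlinarith [sq_nonneg (freq ξ)]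

theorem wt_pos (ξ : ℤ × ℤ) : 0 < wt ξ := one_pos.trans_le (one_le_wt ξ)

theorem abs_fst_le_wt (ξ : ℤ × ℤ) : |(ξ.1 : ℝ)| ≤ wt ξ := by
  rw [wt, freq_sq, abs_le]
  constructor <;> nlinarith [sq_nonneg ((ξ.1 : ℝ) - 1), sq_nonneg ((ξ.1 : ℝ) + 1),
    sq_nonneg (ξ.2 : ℝ), sq_nonneg (ξ.1 : ℝ)]

theorem summable_inv_wt_sq : Summable (fun ξ => (wt ξ ^ 2)⁻¹) := by
  have h1 : Summable (fun n : ℤ => (1 + (n : ℝ) ^ 2)⁻¹) := by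
    have h : Summable (fun n : ℤ => 1 / (n : ℝ) ^ 2) :=
      Real.summable_one_div_int_pow.2 one_lt_two
    have h0 : Summable (fun n : ℤ => if n = 0 then (1 : ℝ) else 0) :=
      summable_of_hasFiniteSupport ((Set.finite_singleton (0 : ℤ)).subset fun n hn => by
        by_contra h; simp_all)
    refine (h.add h0).of_nonneg_of_le (fun n => by positivity) fun n => ?_
    by_cases hn : n = 0
    · simp [hn]
    · have : (0 : ℝ) < (n : ℝ) ^ 2 := by positivity
      rw [if_neg hn, add_zero, one_div]
      exact inv_anti₀ this (by linarith)
  refine (h1.mul_of_nonneg h1 (fun n => by positivity) fun n => by positivity).of_nonneg_of_le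
    (fun ξ => by positivity) fun ξ => ?_
  rw [← mul_inv]
  refine inv_anti₀ (by positivity) ?_
  rw [wt, freq_sq]
  nlinarith [sq_nonneg (ξ.1 : ℝ), sq_nonneg (ξ.2 : ℝ), sq_nonneg ((ξ.1 : ℝ) ^ 2),
    sq_nonneg ((ξ.2 : ℝ) ^ 2), mul_nonneg (sq_nonneg (ξ.1 : ℝ)) (sq_nonneg (ξ.2 : ℝ))]

section H2Le

variable {C D : ℝ} {a b u v : ℤ × ℤ → ℂ}

theorem H2Le.term_le (h : H2Le C a) (ξ : ℤ × ℤ) : wt ξ ^ 2 * ‖a ξ‖ ^ 2 ≤ C :=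
  (h.1.le_tsum ξ fun _ _ => by positivity).trans h.2

theorem H2Le.nonneg (h : H2Le C a) : 0 ≤ C :=
  (tsum_nonneg fun _ => by positivity).trans h.2

theorem H2Le.wt_mul_norm_le (h : H2Le C a) (ξ : ℤ × ℤ) : wt ξ * ‖a ξ‖ ≤ 1 + C := by
  have := h.term_le ξ
  nlinarith [sq_nonneg (wt ξ * ‖a ξ‖ - 1), h.nonneg]

/-- The pointwise form, by the inequality of arithmetic and geometric means, of the embedding of
`H²` in the space of absolutely convergent Fourier series. -/
theorem norm_le_inv_add (a : ℤ × ℤ → ℂ) (ξ : ℤ × ℤ) :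
    ‖a ξ‖ ≤ (wt ξ ^ 2)⁻¹ + wt ξ ^ 2 * ‖a ξ‖ ^ 2 := by
  have hw := wt_pos ξ
  have h : 0 ≤ ((wt ξ)⁻¹ - wt ξ * ‖a ξ‖) ^ 2 := sq_nonneg _
  have e : ((wt ξ)⁻¹ - wt ξ * ‖a ξ‖) ^ 2
      = (wt ξ ^ 2)⁻¹ + wt ξ ^ 2 * ‖a ξ‖ ^ 2 - 2 * ‖a ξ‖ := by
    field_simp
    ring
  rw [e] at h
  linarith [norm_nonneg (a ξ)]

theorem H2Le.summable_norm (h : H2Le C a) : Summable (fun ξ => ‖a ξ‖) :=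
  (summable_inv_wt_sq.add h.1).of_nonneg_of_le (fun _ => norm_nonneg _) (norm_le_inv_add a)

theorem H2Le.tsum_norm_le (h : H2Le C a) :
    ∑' ξ, ‖a ξ‖ ≤ ∑' ξ, (wt ξ ^ 2)⁻¹ + C := by
  refine (h.summable_norm.tsum_le_tsum (norm_le_inv_add a)
    (summable_inv_wt_sq.add h.1)).trans ?_
  rw [summable_inv_wt_sq.tsum_add h.1]
  linarith [h.2]

theorem H2Le.summable_mul_sq (h : H2Le C a) {c : ℤ × ℤ → ℝ} (M : ℝ)
    (hc : ∀ ξ, |c ξ| ≤ M * wt ξ ^ 2) : Summable (fun ξ => c ξ * ‖a ξ‖ ^ 2) := by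
  refine Summable.of_norm_bounded (h.1.mul_left M) fun ξ => ?_
  rw [Real.norm_eq_abs, abs_mul, abs_of_nonneg (sq_nonneg ‖a ξ‖), ← mul_assoc]
  exact mul_le_mul_of_nonneg_right (hc ξ) (sq_nonneg _)

theorem H2Le.summable_sq (h : H2Le C a) : Summable (fun ξ => ‖a ξ‖ ^ 2) := by
  simpa using h.summable_mul_sq (c := fun _ => 1) 1 fun ξ => by
    rw [abs_one, one_mul]; exact one_le_pow₀ (one_le_wt ξ)

theorem H2Le.mono (h : H2Le C a) (hCD : C ≤ D) : H2Le D a := ⟨h.1, h.2.trans hCD⟩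

theorem H2Le.add (ha : H2Le C a) (hb : H2Le D b) : H2Le (2 * (C + D)) (fun ξ => a ξ + b ξ) := by
  have hs := (ha.1.add hb.1).mul_left 2
  have hle : ∀ ξ, wt ξ ^ 2 * ‖a ξ + b ξ‖ ^ 2
      ≤ 2 * (wt ξ ^ 2 * ‖a ξ‖ ^ 2 + wt ξ ^ 2 * ‖b ξ‖ ^ 2) := fun ξ => by
    have h1 : ‖a ξ + b ξ‖ ^ 2 ≤ 2 * (‖a ξ‖ ^ 2 + ‖b ξ‖ ^ 2) := by
      have := pow_le_pow_left₀ (norm_nonneg _) (norm_add_le (a ξ) (b ξ)) 2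
      nlinarith [sq_nonneg (‖a ξ‖ - ‖b ξ‖)]
    nlinarith [mul_le_mul_of_nonneg_left h1 (sq_nonneg (wt ξ))]
  have hs' := hs.of_nonneg_of_le (fun ξ => by positivity) hle
  refine ⟨hs', (hs'.tsum_le_tsum hle hs).trans ?_⟩
  rw [tsum_mul_left, ha.1.tsum_add hb.1]
  linarith [ha.2, hb.2]

theorem H2Le.neg (ha : H2Le C a) : H2Le C (fun ξ => -a ξ) := by
  simpa [H2Le] using ha

theorem H2Le.sub (ha : H2Le C a) (hb : H2Le D b) : H2Le (2 * (C + D)) (fun ξ => a ξ - b ξ) := by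
  simpa [sub_eq_add_neg] using ha.add hb.neg

theorem H2Le.comp_equiv (ha : H2Le C a) (e : ℤ × ℤ ≃ ℤ × ℤ) (he : ∀ ξ, wt (e ξ) = wt ξ) :
    H2Le C (fun ξ => a (e ξ)) := by
  have h : (fun ξ => wt ξ ^ 2 * ‖a (e ξ)‖ ^ 2) = (fun ξ => wt ξ ^ 2 * ‖a ξ‖ ^ 2) ∘ e := by
    funext ξ; simp [he]
  refine ⟨?_, ?_⟩
  · rw [h, e.summable_iff]; exact ha.1
  · rw [h]; exact (e.tsum_eq (fun ξ => wt ξ ^ 2 * ‖a ξ‖ ^ 2)).trans_le ha.2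

/-- The bijection `(ξ, ζ) ↦ (ζ, ξ - ζ)`, under which a convolution becomes a product. -/
def shear : (ℤ × ℤ) × (ℤ × ℤ) ≃ (ℤ × ℤ) × (ℤ × ℤ) where
  toFun p := (p.2, p.1 - p.2)
  invFun q := (q.1 + q.2, q.1)
  left_inv p := by simp
  right_inv q := by simp

theorem summable_norm_mul_norm (hu : Summable (fun ξ => ‖u ξ‖))
    (hv : Summable (fun ξ => ‖v ξ‖)) :
    Summable (fun q : (ℤ × ℤ) × (ℤ × ℤ) => ‖u q.1‖ * ‖v q.2‖) := by
  exact Summable.mul_of_nonneg (f := fun ξ => ‖u ξ‖) (g := fun ξ => ‖v ξ‖) hu hv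
    (fun ξ => norm_nonneg (u ξ)) fun ξ => norm_nonneg (v ξ)

theorem summable_conv_prod (hu : Summable (fun ξ => ‖u ξ‖)) (hv : Summable (fun ξ => ‖v ξ‖)) :
    Summable (fun p : (ℤ × ℤ) × (ℤ × ℤ) => ‖u p.2‖ * ‖v (p.1 - p.2)‖) :=
  (shear.summable_iff (f := fun q : (ℤ × ℤ) × (ℤ × ℤ) => ‖u q.1‖ * ‖v q.2‖)).2
    (summable_norm_mul_norm hu hv)

theorem tsum_conv_prod (hu : Summable (fun ξ => ‖u ξ‖)) (hv : Summable (fun ξ => ‖v ξ‖)) :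
    ∑' p : (ℤ × ℤ) × (ℤ × ℤ), ‖u p.2‖ * ‖v (p.1 - p.2)‖ = (∑' ξ, ‖u ξ‖) * ∑' ξ, ‖v ξ‖ := by
  rw [hu.tsum_mul_tsum hv (summable_norm_mul_norm hu hv)]
  exact shear.tsum_eq (fun q : (ℤ × ℤ) × (ℤ × ℤ) => ‖u q.1‖ * ‖v q.2‖)

theorem summable_conv_term (hu : Summable (fun ξ => ‖u ξ‖)) (hv : Summable (fun ξ => ‖v ξ‖))
    (ξ : ℤ × ℤ) : Summable (fun ζ => u ζ * v (ξ - ζ)) :=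
  .of_norm (by simpa only [norm_mul] using (summable_conv_prod hu hv).prod_factor ξ)

theorem norm_conv_le (hu : Summable (fun ξ => ‖u ξ‖)) (hv : Summable (fun ξ => ‖v ξ‖))
    (ξ : ℤ × ℤ) : ‖conv u v ξ‖ ≤ ∑' ζ, ‖u ζ‖ * ‖v (ξ - ζ)‖ := by
  unfold conv
  have h := norm_tsum_le_tsum_norm (f := fun ζ => u ζ * v (ξ - ζ))
    (by simpa only [norm_mul] using (summable_conv_prod hu hv).prod_factor ξ)
  simpa only [norm_mul] using h

theorem summable_norm_conv (hu : Summable (fun ξ => ‖u ξ‖)) (hv : Summable (fun ξ => ‖v ξ‖)) :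
    Summable (fun ξ => ‖conv u v ξ‖) :=
  (summable_conv_prod hu hv).prod.of_nonneg_of_le (fun _ => norm_nonneg _) (norm_conv_le hu hv)

theorem tsum_norm_conv_le (hu : Summable (fun ξ => ‖u ξ‖)) (hv : Summable (fun ξ => ‖v ξ‖)) :
    ∑' ξ, ‖conv u v ξ‖ ≤ (∑' ξ, ‖u ξ‖) * ∑' ξ, ‖v ξ‖ := by
  rw [← tsum_conv_prod hu hv, (summable_conv_prod hu hv).tsum_prod]
  exact (summable_norm_conv hu hv).tsum_le_tsum (norm_conv_le hu hv) (summable_conv_prod hu hv).prod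

/-- The convection term does no work: `∑ conj (a ξ) ξ₁ (a * a) ξ = 0`. The sum runs over triples
`p + q + s = 0` with summand `-p₁ a p a q a s`, and averaging over the permutations of the triple
replaces `p₁` by `(p₁ + q₁ + s₁) / 3 = 0`. -/
theorem hasSum_conj_mul_fst_mul_conv (ha : H2Le C a) (hreal : ∀ ξ, a (-ξ) = conj (a ξ)) :
    HasSum (fun ξ : ℤ × ℤ => conj (a ξ) * ((ξ.1 : ℂ) * conv a a ξ)) 0 := by
  set f : (ℤ × ℤ) × (ℤ × ℤ) → ℂ := fun p =>
    (p.1.1 : ℂ) * a (-p.1) * (a p.2 * a (p.1 - p.2)) with hf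
  have hfs : Summable f := by
    refine Summable.of_norm_bounded
      ((summable_conv_prod ha.summable_norm ha.summable_norm).mul_left (1 + C)) fun p => ?_
    rw [hf]
    simp only [norm_mul, hreal, RCLike.norm_conj, Complex.norm_intCast]
    refine mul_le_mul_of_nonneg_right ?_ (by positivity)
    exact (mul_le_mul_of_nonneg_right (abs_fst_le_wt _) (norm_nonneg _)).trans
      (ha.wt_mul_norm_le _)
  let e₁ : (ℤ × ℤ) × (ℤ × ℤ) ≃ (ℤ × ℤ) × (ℤ × ℤ) :=
    { toFun := fun p => (-p.2, -p.1)
      invFun := fun p => (-p.2, -p.1)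
      left_inv := fun p => by simp
      right_inv := fun p => by simp }
  let e₂ : (ℤ × ℤ) × (ℤ × ℤ) ≃ (ℤ × ℤ) × (ℤ × ℤ) :=
    { toFun := fun p => (p.2 - p.1, p.2)
      invFun := fun p => (p.2 - p.1, p.2)
      left_inv := fun p => by simp
      right_inv := fun p => by simp }
  have h0 : ∑' p, f p = 0 := by
    have h1 : ∑' p, f (e₁ p) = ∑' p, f p := e₁.tsum_eq f
    have h2 : ∑' p, f (e₂ p) = ∑' p, f p := e₂.tsum_eq f
    have s1 : Summable (fun p => f (e₁ p)) := (e₁.summable_iff (f := f)).2 hfs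
    have s2 : Summable (fun p => f (e₂ p)) := (e₂.summable_iff (f := f)).2 hfs
    have h3 : ∑' p, (f p + f (e₁ p) + f (e₂ p)) = 0 := by
      rw [← tsum_zero (α := ℂ) (β := (ℤ × ℤ) × (ℤ × ℤ))]
      refine tsum_congr fun p => ?_
      simp only [hf, e₁, e₂, Equiv.coe_fn_mk, neg_neg, neg_sub, neg_sub_neg, Prod.fst_neg,
        Prod.fst_sub, Int.cast_neg, Int.cast_sub]
      rw [show p.2 - p.1 - p.2 = -p.1 by abel]
      ring
    rw [(hfs.add s1).tsum_add s2, hfs.tsum_add s1, h1, h2] at h3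
    linear_combination h3 / 3
  have h := hfs.hasSum.prod_fiberwise fun ξ => (hfs.prod_factor ξ).hasSum
  rw [h0] at h
  convert h using 2 with ξ
  rw [hf]
  simp only
  rw [tsum_mul_left, hreal, conv]
  ring

end H2Le

/-! ### The equation for the Fourier coefficients -/

/-- The symbol of the linear part `-(β - 1) ∂ₓ² + ∂_y² + δ Λ³ - ε Δ²`. -/
def symb (β δ ε : ℝ) (ξ : ℤ × ℤ) : ℝ :=
  (β - 1) * (ξ.1 : ℝ) ^ 2 - (ξ.2 : ℝ) ^ 2 + δ * freq ξ ^ 3 - ε * freq ξ ^ 4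

/-- The time derivative `σ(ξ) a(ξ) - (i ξ₁ / 2) (a * a)(ξ)` of the Fourier coefficients. -/
def rate (β δ ε : ℝ) (a : ℤ × ℤ → ℂ) (ξ : ℤ × ℤ) : ℂ :=
  (symb β δ ε ξ : ℂ) * a ξ - Complex.I * (ξ.1 : ℂ) / 2 * conv a a ξ

theorem abs_symb_le (β δ ε : ℝ) (ξ : ℤ × ℤ) :
    |symb β δ ε ξ| ≤ (|β - 1| + 1 + |δ| + |ε|) * wt ξ ^ 2 := by
  have hr := freq_nonneg ξ
  have hsq := freq_sq ξ
  have hx : (ξ.1 : ℝ) ^ 2 ≤ wt ξ ^ 2 := by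
    have : (ξ.1 : ℝ) ^ 2 ≤ freq ξ ^ 2 := by rw [hsq]; nlinarith [sq_nonneg (ξ.2 : ℝ)]
    unfold wt; nlinarith [sq_nonneg (freq ξ), sq_nonneg (freq ξ ^ 2)]
  have hy : (ξ.2 : ℝ) ^ 2 ≤ wt ξ ^ 2 := by
    have : (ξ.2 : ℝ) ^ 2 ≤ freq ξ ^ 2 := by rw [hsq]; nlinarith [sq_nonneg (ξ.1 : ℝ)]
    unfold wt; nlinarith [sq_nonneg (freq ξ), sq_nonneg (freq ξ ^ 2)]
  have h3 : freq ξ ^ 3 ≤ wt ξ ^ 2 := by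
    unfold wt
    nlinarith [sq_nonneg (freq ξ), sq_nonneg (freq ξ ^ 2), mul_nonneg (sq_nonneg (freq ξ))
      (sq_nonneg (freq ξ - 1))]
  have h4 : freq ξ ^ 4 ≤ wt ξ ^ 2 := by
    unfold wt; nlinarith [sq_nonneg (freq ξ), sq_nonneg (freq ξ ^ 2)]
  have t1 : |(β - 1) * (ξ.1 : ℝ) ^ 2| ≤ |β - 1| * wt ξ ^ 2 := by
    rw [abs_mul, abs_of_nonneg (sq_nonneg (ξ.1 : ℝ))]; gcongr
  have t2 : |(ξ.2 : ℝ) ^ 2| ≤ wt ξ ^ 2 := by rwa [abs_of_nonneg (sq_nonneg (ξ.2 : ℝ))]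
  have t3 : |δ * freq ξ ^ 3| ≤ |δ| * wt ξ ^ 2 := by
    rw [abs_mul, abs_of_nonneg (by positivity : 0 ≤ freq ξ ^ 3)]; gcongr
  have t4 : |ε * freq ξ ^ 4| ≤ |ε| * wt ξ ^ 2 := by
    rw [abs_mul, abs_of_nonneg (by positivity : 0 ≤ freq ξ ^ 4)]; gcongr
  unfold symb
  rw [abs_le] at *
  constructor <;> linarith [t1.1, t1.2, t2.1, t2.2, t3.1, t3.2, t4.1, t4.2]

/-- A bound, uniform on bounded sets of `H²`, for the pairing of the right-hand side of the
equation with another `H²` sequence. -/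
theorem exists_bound_pairing (β δ ε C : ℝ) : ∃ C' : ℝ, ∀ h a u v : ℤ × ℤ → ℂ,
    H2Le C h → H2Le C a → H2Le C u → H2Le C v →
    Summable (fun ξ : ℤ × ℤ =>
      ‖h ξ‖ * ‖(symb β δ ε ξ : ℂ) * a ξ - Complex.I * (ξ.1 : ℂ) / 2 * conv u v ξ‖) ∧
    ∑' ξ : ℤ × ℤ,
      ‖h ξ‖ * ‖(symb β δ ε ξ : ℂ) * a ξ - Complex.I * (ξ.1 : ℂ) / 2 * conv u v ξ‖ ≤ C' := by
  set S := |β - 1| + 1 + |δ| + |ε| with hS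
  have hS0 : 0 ≤ S := by positivity
  set W := ∑' ξ, (wt ξ ^ 2)⁻¹
  refine ⟨S * (C + C) + (1 + C) * ((W + C) * (W + C)), fun h a u v hh ha hu hv => ?_⟩
  have hle : ∀ ξ : ℤ × ℤ,
      ‖h ξ‖ * ‖(symb β δ ε ξ : ℂ) * a ξ - Complex.I * (ξ.1 : ℂ) / 2 * conv u v ξ‖
      ≤ S * (wt ξ ^ 2 * ‖h ξ‖ ^ 2 + wt ξ ^ 2 * ‖a ξ‖ ^ 2) + (1 + C) * ‖conv u v ξ‖ := by
    intro ξ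
    have h1 : ‖(symb β δ ε ξ : ℂ) * a ξ - Complex.I * (ξ.1 : ℂ) / 2 * conv u v ξ‖
        ≤ S * wt ξ ^ 2 * ‖a ξ‖ + wt ξ * ‖conv u v ξ‖ := by
      refine (norm_sub_le _ _).trans (add_le_add ?_ ?_)
      · rw [norm_mul, Complex.norm_real]
        exact mul_le_mul_of_nonneg_right (abs_symb_le β δ ε ξ) (norm_nonneg _)
      · rw [norm_mul]
        refine mul_le_mul_of_nonneg_right ?_ (norm_nonneg _)
        simp only [norm_div, norm_mul, Complex.norm_I, one_mul, Complex.norm_intCast,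
          Complex.norm_ofNat]
        linarith [abs_fst_le_wt ξ, abs_nonneg (ξ.1 : ℝ)]
    have h2 := hh.wt_mul_norm_le ξ
    calc _ ≤ ‖h ξ‖ * (S * wt ξ ^ 2 * ‖a ξ‖ + wt ξ * ‖conv u v ξ‖) :=
          mul_le_mul_of_nonneg_left h1 (norm_nonneg _)
      _ = S * wt ξ ^ 2 * (‖h ξ‖ * ‖a ξ‖) + wt ξ * ‖h ξ‖ * ‖conv u v ξ‖ := by ring
      _ ≤ S * wt ξ ^ 2 * (‖h ξ‖ ^ 2 + ‖a ξ‖ ^ 2) + (1 + C) * ‖conv u v ξ‖ := by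
          gcongr
          nlinarith [sq_nonneg (‖h ξ‖ - ‖a ξ‖), sq_nonneg ‖h ξ‖, sq_nonneg ‖a ξ‖]
      _ = _ := by ring
  have hc := summable_norm_conv hu.summable_norm hv.summable_norm
  have hs := ((hh.1.add ha.1).mul_left S).add (hc.mul_left (1 + C))
  have hs' := hs.of_nonneg_of_le (fun ξ => by positivity) hle
  refine ⟨hs', (hs'.tsum_le_tsum hle hs).trans ?_⟩
  rw [((hh.1.add ha.1).mul_left S).tsum_add (hc.mul_left (1 + C)), tsum_mul_left, tsum_mul_left,
    hh.1.tsum_add ha.1]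
  have hC := hh.nonneg
  have hcc := tsum_norm_conv_le hu.summable_norm hv.summable_norm
  have := hu.tsum_norm_le
  have := hv.tsum_norm_le
  have hu0 : 0 ≤ ∑' ξ, ‖u ξ‖ := tsum_nonneg fun _ => norm_nonneg _
  have hv0 : 0 ≤ ∑' ξ, ‖v ξ‖ := tsum_nonneg fun _ => norm_nonneg _
  have hW : 0 ≤ W + C := hu0.trans hu.tsum_norm_le
  gcongr
  · exact hh.2
  · exact ha.2
  · exact hcc.trans (by gcongr)

/-- A path of sequences on `[0, T]` solving the equation for the Fourier coefficients of a real
solution, bounded in `H²`. -/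
structure IsModeFlow (β δ ε T C : ℝ) (a : ℝ → ℤ × ℤ → ℂ) : Prop where
  real : ∀ t ∈ Set.Icc 0 T, ∀ ξ, a t (-ξ) = conj (a t ξ)
  bound : ∀ t ∈ Set.Icc 0 T, H2Le C (a t)
  cont : ∀ ξ, ContinuousOn (fun t => a t ξ) (Set.Icc 0 T)
  duhamel : ∀ ξ, ∀ t ∈ Set.Icc 0 T,
    a t ξ - a 0 ξ = ∫ r in (0 : ℝ)..t, rate β δ ε (a r) ξ

theorem continuousOn_conv {C : ℝ} {s : Set ℝ} {a b : ℝ → ℤ × ℤ → ℂ}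
    (ha : ∀ ξ, ContinuousOn (fun t => a t ξ) s) (hb : ∀ ξ, ContinuousOn (fun t => b t ξ) s)
    (hCa : ∀ t ∈ s, H2Le C (a t)) (hCb : ∀ t ∈ s, H2Le C (b t)) (ξ : ℤ × ℤ) :
    ContinuousOn (fun t => conv (a t) (b t) ξ) s := by
  unfold conv
  have hsub : Summable (fun ζ => (wt (ξ - ζ) ^ 2)⁻¹) :=
    ((Equiv.subLeft ξ).summable_iff (f := fun ζ => (wt ζ ^ 2)⁻¹)).2 summable_inv_wt_sq
  refine continuousOn_tsum (u := fun ζ => (1 + C) ^ 2 * ((wt ζ ^ 2)⁻¹ + (wt (ξ - ζ) ^ 2)⁻¹))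
    (fun ζ => (ha ζ).mul (hb _)) ((summable_inv_wt_sq.add hsub).mul_left _) fun ζ t ht => ?_
  rw [norm_mul]
  have h1 : ‖a t ζ‖ ≤ (1 + C) * (wt ζ)⁻¹ := by
    rw [← div_eq_mul_inv, le_div_iff₀' (wt_pos _)]; exact (hCa t ht).wt_mul_norm_le ζ
  have h2 : ‖b t (ξ - ζ)‖ ≤ (1 + C) * (wt (ξ - ζ))⁻¹ := by
    rw [← div_eq_mul_inv, le_div_iff₀' (wt_pos _)]; exact (hCb t ht).wt_mul_norm_le _
  have h0 := (hCa t ht).nonneg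
  have hi1 := inv_nonneg.2 (wt_pos ζ).le
  have hi2 := inv_nonneg.2 (wt_pos (ξ - ζ)).le
  refine (mul_le_mul h1 h2 (norm_nonneg _) (by positivity)).trans ?_
  rw [← inv_pow, ← inv_pow]
  have : (wt ζ)⁻¹ * (wt (ξ - ζ))⁻¹ ≤ (wt ζ)⁻¹ ^ 2 + (wt (ξ - ζ))⁻¹ ^ 2 := by
    nlinarith [sq_nonneg ((wt ζ)⁻¹ - (wt (ξ - ζ))⁻¹)]
  nlinarith [mul_le_mul_of_nonneg_left this (sq_nonneg (1 + C))]

theorem IsModeFlow.continuousOn_rate {β δ ε T C : ℝ} {a : ℝ → ℤ × ℤ → ℂ}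
    (h : IsModeFlow β δ ε T C a) (ξ : ℤ × ℤ) :
    ContinuousOn (fun t => rate β δ ε (a t) ξ) (Set.Icc 0 T) :=
  ((h.cont ξ).const_mul _).sub
    ((continuousOn_conv h.cont h.cont h.bound h.bound ξ).const_mul _)

/-- The symbol is dominated by `-ε |ξ|⁴ / 2` at high frequency, with room for a term `D ξ₁²`. -/
theorem exists_two_mul_symb_le (β δ : ℝ) {ε : ℝ} (hε : 0 < ε) (D : ℝ) :
    ∃ K : ℝ, 0 ≤ K ∧ ∀ ξ : ℤ × ℤ,
      2 * symb β δ ε ξ + D * (ξ.1 : ℝ) ^ 2 + ε * freq ξ ^ 4 ≤ K := by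
  set P := 2 * |β - 1| + |D| with hP
  set Q := P + 2 * δ ^ 2 / ε with hQ
  have hP0 : 0 ≤ P := by positivity
  have hQ0 : 0 ≤ Q := by positivity
  refine ⟨Q ^ 2 / (2 * ε), by positivity, fun ξ => ?_⟩
  have hr := freq_nonneg ξ
  have hsq := freq_sq ξ
  have hx : (ξ.1 : ℝ) ^ 2 ≤ freq ξ ^ 2 := by rw [hsq]; nlinarith [sq_nonneg (ξ.2 : ℝ)]
  have h1 : (2 * (β - 1) + D) * (ξ.1 : ℝ) ^ 2 ≤ P * freq ξ ^ 2 := by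
    have : 2 * (β - 1) + D ≤ P := by linarith [le_abs_self (β - 1), le_abs_self D]
    nlinarith [sq_nonneg (ξ.1 : ℝ)]
  have h2 : 2 * δ * freq ξ ^ 3 ≤ ε / 2 * freq ξ ^ 4 + 2 * δ ^ 2 / ε * freq ξ ^ 2 := by
    have h : ε / 2 * freq ξ ^ 4 + 2 * δ ^ 2 / ε * freq ξ ^ 2 - 2 * δ * freq ξ ^ 3
        = (freq ξ * (ε * freq ξ - 2 * δ)) ^ 2 / (2 * ε) := by field_simp; ring
    have h' : 0 ≤ (freq ξ * (ε * freq ξ - 2 * δ)) ^ 2 / (2 * ε) := by positivity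
    linarith
  have h3 : Q * freq ξ ^ 2 ≤ ε / 2 * freq ξ ^ 4 + Q ^ 2 / (2 * ε) := by
    have h : ε / 2 * freq ξ ^ 4 + Q ^ 2 / (2 * ε) - Q * freq ξ ^ 2
        = (ε * freq ξ ^ 2 - Q) ^ 2 / (2 * ε) := by field_simp; ring
    have h' : 0 ≤ (ε * freq ξ ^ 2 - Q) ^ 2 / (2 * ε) := by positivity
    linarith
  have h4 : Q * freq ξ ^ 2 = P * freq ξ ^ 2 + 2 * δ ^ 2 / ε * freq ξ ^ 2 := by rw [hQ]; ring
  unfold symb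
  nlinarith [sq_nonneg (ξ.2 : ℝ)]

/-! ### Persistence of odd symmetry -/

/-- The reflection `(ξ₁, ξ₂) ↦ (-ξ₁, ξ₂)`. -/
def reflX : ℤ × ℤ ≃ ℤ × ℤ where
  toFun ξ := (-ξ.1, ξ.2)
  invFun ξ := (-ξ.1, ξ.2)
  left_inv ξ := by simp
  right_inv ξ := by simp

theorem reflX_apply (ξ : ℤ × ℤ) : reflX ξ = (-ξ.1, ξ.2) := rfl

theorem freq_reflX (ξ : ℤ × ℤ) : freq (reflX ξ) = freq ξ := by
  simp [freq, reflX_apply]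

theorem wt_reflX (ξ : ℤ × ℤ) : wt (reflX ξ) = wt ξ := by rw [wt, wt, freq_reflX]

theorem symb_reflX (β δ ε : ℝ) (ξ : ℤ × ℤ) : symb β δ ε (reflX ξ) = symb β δ ε ξ := by
  rw [symb, symb, freq_reflX]
  simp [reflX_apply]

theorem conv_reflX (a : ℤ × ℤ → ℂ) (ξ : ℤ × ℤ) :
    conv a a (reflX ξ) = conv (fun ζ => a (reflX ζ)) (fun ζ => a (reflX ζ)) ξ := by
  unfold conv
  rw [← reflX.tsum_eq (fun ζ => a ζ * a (reflX ξ - ζ))]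
  refine tsum_congr fun ζ => ?_
  have : reflX ξ - reflX ζ = reflX (ξ - ζ) := by
    simp only [reflX_apply, Prod.mk_sub_mk, Prod.fst_sub, Prod.snd_sub, Prod.mk.injEq, and_true]
    ring
  rw [this]

theorem conv_comm (u v : ℤ × ℤ → ℂ) (ξ : ℤ × ℤ) : conv u v ξ = conv v u ξ := by
  unfold conv
  rw [← (Equiv.subLeft ξ).tsum_eq (fun ζ => v ζ * u (ξ - ζ))]
  refine tsum_congr fun ζ => ?_
  simp [mul_comm]

theorem conv_sub_conv {u v : ℤ × ℤ → ℂ} (hu : Summable (fun ξ => ‖u ξ‖))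
    (hv : Summable (fun ξ => ‖v ξ‖)) (ξ : ℤ × ℤ) :
    conv u u ξ - conv v v ξ = conv (fun ζ => u ζ + v ζ) (fun ζ => u ζ - v ζ) ξ := by
  have h : conv (fun ζ => u ζ + v ζ) (fun ζ => u ζ - v ζ) ξ
      = conv u u ξ - conv u v ξ + (conv v u ξ - conv v v ξ) := by
    have huu := summable_conv_term hu hu ξ
    have huv := summable_conv_term hu hv ξ
    have hvu := summable_conv_term hv hu ξ
    have hvv := summable_conv_term hv hv ξ
    unfold conv
    rw [← huu.tsum_sub huv, ← hvu.tsum_sub hvv, ← (huu.sub huv).tsum_add (hvu.sub hvv)]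
    exact tsum_congr fun ζ => by ring
  rw [h, conv_comm v u]
  ring

/-- Young's inequality for the pairing of `p` with the convolution of `q` and an `ℓ¹` sequence. -/
theorem tsum_mul_conv_le {d : ℤ × ℤ → ℂ} {p q : ℤ × ℤ → ℝ} (hd : Summable (fun ξ => ‖d ξ‖))
    (hp : Summable (fun ξ => p ξ ^ 2)) (hq : Summable (fun ξ => q ξ ^ 2))
    (hp0 : ∀ ξ, 0 ≤ p ξ) (hq0 : ∀ ξ, 0 ≤ q ξ) :
    Summable (fun ξ => p ξ * ∑' ζ, q ζ * ‖d (ξ - ζ)‖) ∧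
    ∑' ξ, p ξ * ∑' ζ, q ζ * ‖d (ξ - ζ)‖
      ≤ (∑' ξ, ‖d ξ‖) * (∑' ξ, p ξ ^ 2 + ∑' ξ, q ξ ^ 2) / 2 := by
  let e : (ℤ × ℤ) × (ℤ × ℤ) ≃ (ℤ × ℤ) × (ℤ × ℤ) :=
    { toFun := fun x => (x.1, x.1 - x.2)
      invFun := fun x => (x.1, x.1 - x.2)
      left_inv := fun x => by simp
      right_inv := fun x => by simp }
  have h1 : HasSum (fun x : (ℤ × ℤ) × (ℤ × ℤ) => p x.1 ^ 2 * ‖d (x.1 - x.2)‖)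
      ((∑' ξ, p ξ ^ 2) * ∑' ξ, ‖d ξ‖) := by
    have hs := Summable.mul_of_nonneg (f := fun ξ => p ξ ^ 2) (g := fun ξ => ‖d ξ‖) hp hd
      (fun ξ => sq_nonneg (p ξ)) fun ξ => norm_nonneg (d ξ)
    exact (e.hasSum_iff (f := fun x : (ℤ × ℤ) × (ℤ × ℤ) => p x.1 ^ 2 * ‖d x.2‖)).2
      (hp.hasSum.mul hd.hasSum hs)
  have h2 : HasSum (fun x : (ℤ × ℤ) × (ℤ × ℤ) => q x.2 ^ 2 * ‖d (x.1 - x.2)‖)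
      ((∑' ξ, q ξ ^ 2) * ∑' ξ, ‖d ξ‖) := by
    have hs := Summable.mul_of_nonneg (f := fun ξ => q ξ ^ 2) (g := fun ξ => ‖d ξ‖) hq hd
      (fun ξ => sq_nonneg (q ξ)) fun ξ => norm_nonneg (d ξ)
    exact (shear.hasSum_iff (f := fun x : (ℤ × ℤ) × (ℤ × ℤ) => q x.1 ^ 2 * ‖d x.2‖)).2
      (hq.hasSum.mul hd.hasSum hs)
  have h3 := (h1.add h2).div_const 2
  set f : (ℤ × ℤ) × (ℤ × ℤ) → ℝ := fun x => p x.1 * (q x.2 * ‖d (x.1 - x.2)‖) with hf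
  have hle : ∀ x : (ℤ × ℤ) × (ℤ × ℤ),
      f x ≤ (p x.1 ^ 2 * ‖d (x.1 - x.2)‖ + q x.2 ^ 2 * ‖d (x.1 - x.2)‖) / 2 := fun x => by
    have := mul_nonneg (sq_nonneg (p x.1 - q x.2)) (norm_nonneg (d (x.1 - x.2)))
    simp only [hf]
    nlinarith
  have hf0 : ∀ x, 0 ≤ f x := fun x =>
    mul_nonneg (hp0 _) (mul_nonneg (hq0 _) (norm_nonneg _))
  have hfs : Summable f := h3.summable.of_nonneg_of_le hf0 hle
  have hin : ∀ ξ, ∑' ζ, f (ξ, ζ) = p ξ * ∑' ζ, q ζ * ‖d (ξ - ζ)‖ := fun ξ => by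
    simp only [hf]; rw [tsum_mul_left]
  have hsum := hfs.prod
  simp only [hin] at hsum
  refine ⟨hsum, ?_⟩
  have ht := hfs.tsum_prod
  simp only [hin] at ht
  rw [← ht]
  refine (hfs.tsum_le_tsum hle h3.summable).trans_eq ?_
  rw [h3.tsum_eq]
  ring

theorem inner_symb_sub_le (σ : ℝ) (k : ℤ) (e c : ℂ) :
    2 * inner ℝ e ((σ : ℂ) * e - Complex.I * (k : ℂ) / 2 * c)
      ≤ 2 * σ * ‖e‖ ^ 2 + |(k : ℝ)| * ‖e‖ * ‖c‖ := by
  have h1 : inner ℝ e ((σ : ℂ) * e) = σ * ‖e‖ ^ 2 := by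
    rw [← real_inner_self_eq_norm_sq, ← inner_smul_right, Complex.real_smul]
  have h2 : -inner ℝ e (Complex.I * (k : ℂ) / 2 * c) ≤ ‖e‖ * (|(k : ℝ)| / 2 * ‖c‖) := by
    refine (neg_le_abs _).trans ((abs_real_inner_le_norm _ _).trans_eq ?_)
    simp only [norm_div, norm_mul, Complex.norm_I, one_mul, Complex.norm_intCast,
      Complex.norm_ofNat]
  rw [inner_sub_right, h1]
  linarith

/-- Odd symmetry persists: by Grönwall's inequality for the even part `a ξ + a (reflX ξ)`, which
solves a linear equation with the odd part of `a` as coefficient. -/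
theorem IsModeFlow.odd {β δ ε T C : ℝ} (hε : 0 < ε) {a : ℝ → ℤ × ℤ → ℂ}
    (h : IsModeFlow β δ ε T C a) (h0 : ∀ ξ, a 0 (reflX ξ) = -a 0 ξ)
    {t : ℝ} (ht : t ∈ Set.Icc 0 T) (ξ : ℤ × ℤ) : a t (reflX ξ) = -a t ξ := by
  have hT : 0 ≤ T := ht.1.trans ht.2
  have hC : 0 ≤ C := (h.bound 0 ⟨le_rfl, hT⟩).nonneg
  set e : ℝ → ℤ × ℤ → ℂ := fun t ξ => a t ξ + a t (reflX ξ) with he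
  set d : ℝ → ℤ × ℤ → ℂ := fun t ξ => a t ξ - a t (reflX ξ) with hd
  have hr : ∀ t ∈ Set.Icc 0 T, H2Le C (fun ξ => a t (reflX ξ)) := fun t ht =>
    (h.bound t ht).comp_equiv reflX wt_reflX
  have heC : ∀ t ∈ Set.Icc 0 T, H2Le (2 * (C + C)) (e t) := fun t ht =>
    (h.bound t ht).add (hr t ht)
  have hdC : ∀ t ∈ Set.Icc 0 T, H2Le (2 * (C + C)) (d t) := fun t ht =>
    (h.bound t ht).sub (hr t ht)
  have hrate : ∀ t ∈ Set.Icc 0 T, ∀ ξ, rate β δ ε (a t) ξ + rate β δ ε (a t) (reflX ξ)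
      = (symb β δ ε ξ : ℂ) * e t ξ - Complex.I * (ξ.1 : ℂ) / 2 * conv (e t) (d t) ξ := by
    intro t ht ξ
    simp only [he, hd]
    rw [← conv_sub_conv (h.bound t ht).summable_norm (hr t ht).summable_norm, ← conv_reflX]
    simp only [rate, symb_reflX]
    rw [reflX_apply]
    push_cast
    ring
  obtain ⟨C', hC'⟩ := exists_bound_pairing β δ ε (2 * (C + C))
  set W := ∑' ξ, (wt ξ ^ 2)⁻¹ with hW
  set B := W + 2 * (C + C) with hB
  obtain ⟨K, hK0, hK⟩ := exists_two_mul_symb_le β δ hε (B / 2)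
  have hB0 : 0 ≤ B := (tsum_nonneg fun _ => norm_nonneg _).trans
    (hdC 0 ⟨le_rfl, hT⟩).tsum_norm_le
  have hgr := energy_gronwall (T := T) (C := C') (K := K + B / 2) (D := 0) (b := e)
    (n := fun t ξ => rate β δ ε (a t) ξ + rate β δ ε (a t) (reflX ξ))
    (fun ξ => (h.continuousOn_rate ξ).add (h.continuousOn_rate _)) ?_ ?_
    (fun t ht => (heC t ht).summable_sq) ?_ ht
  · have hz : ∑' ξ, ‖e 0 ξ‖ ^ 2 = 0 := by simp [he, h0]
    rw [hz, gronwallBound_ε0_δ0] at hgr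
    have h1 := ((heC t ht).summable_sq.le_tsum ξ fun _ _ => by positivity).trans hgr
    have h2 : e t ξ = 0 := by
      have : ‖e t ξ‖ = 0 := by nlinarith [norm_nonneg (e t ξ)]
      exact norm_eq_zero.1 this
    exact eq_neg_of_add_eq_zero_right h2
  · intro ξ t ht
    have hi : ∀ ξ, IntervalIntegrable (fun r => rate β δ ε (a r) ξ) volume 0 t := fun ξ => by
      apply ContinuousOn.intervalIntegrable
      rw [Set.uIcc_of_le ht.1]
      exact (h.continuousOn_rate ξ).mono (Set.Icc_subset_Icc_right ht.2)
    rw [intervalIntegral.integral_add (hi _) (hi _), ← h.duhamel ξ t ht,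
      ← h.duhamel (reflX ξ) t ht]
    simp only [he]
    ring
  · intro t ht
    simp only [hrate t ht]
    exact hC' _ _ _ _ (heC t ht) (heC t ht) (heC t ht) (hdC t ht)
  · intro t ht
    simp only [hrate t ht, add_zero]
    have he' := heC t ht
    have hd' := hdC t ht
    have hσ : Summable (fun ξ => 2 * symb β δ ε ξ * ‖e t ξ‖ ^ 2) := by
      simpa only [mul_assoc] using (he'.summable_mul_sq _ (abs_symb_le β δ ε)).mul_left 2
    have hx : Summable (fun ξ : ℤ × ℤ => (|(ξ.1 : ℝ)| * ‖e t ξ‖) ^ 2) := by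
      simp only [mul_pow]
      refine he'.summable_mul_sq 1 fun ξ => ?_
      rw [abs_of_nonneg (by positivity), one_mul]
      exact pow_le_pow_left₀ (abs_nonneg _) (abs_fst_le_wt ξ) 2
    obtain ⟨hy1, hy2⟩ := tsum_mul_conv_le hd'.summable_norm hx he'.summable_sq
      (fun ξ => by positivity) (fun ξ => norm_nonneg _)
    have hle : ∀ ξ : ℤ × ℤ, 2 * inner ℝ (e t ξ) ((symb β δ ε ξ : ℂ) * e t ξ
        - Complex.I * (ξ.1 : ℂ) / 2 * conv (e t) (d t) ξ)
        ≤ 2 * symb β δ ε ξ * ‖e t ξ‖ ^ 2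
          + |(ξ.1 : ℝ)| * ‖e t ξ‖ * ∑' ζ, ‖e t ζ‖ * ‖d t (ξ - ζ)‖ := fun ξ =>
      (inner_symb_sub_le _ _ _ _).trans (by
        gcongr
        exact norm_conv_le he'.summable_norm hd'.summable_norm ξ)
    have hs : Summable (fun ξ : ℤ × ℤ => 2 * inner ℝ (e t ξ) ((symb β δ ε ξ : ℂ) * e t ξ
        - Complex.I * (ξ.1 : ℂ) / 2 * conv (e t) (d t) ξ)) := by
      refine Summable.of_norm_bounded ((hC' _ _ _ _ he' he' he' hd').1.mul_left 2) fun ξ => ?_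
      rw [Real.norm_eq_abs, abs_mul, abs_two]
      exact mul_le_mul_of_nonneg_left (abs_real_inner_le_norm _ _) two_pos.le
    refine (hs.tsum_le_tsum hle (hσ.add hy1)).trans ?_
    rw [hσ.tsum_add hy1]
    have hdB : ∑' ξ, ‖d t ξ‖ ≤ B := hd'.tsum_norm_le
    have hX0 : 0 ≤ ∑' ξ : ℤ × ℤ, (|(ξ.1 : ℝ)| * ‖e t ξ‖) ^ 2 := tsum_nonneg fun _ => sq_nonneg _
    have hE0 : 0 ≤ ∑' ξ, ‖e t ξ‖ ^ 2 := tsum_nonneg fun _ => sq_nonneg _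
    have h5 : ∑' ξ, 2 * symb β δ ε ξ * ‖e t ξ‖ ^ 2
        + B / 2 * ∑' ξ : ℤ × ℤ, (|(ξ.1 : ℝ)| * ‖e t ξ‖) ^ 2 ≤ K * ∑' ξ, ‖e t ξ‖ ^ 2 := by
      rw [← tsum_mul_left, ← tsum_mul_left, ← hσ.tsum_add (hx.mul_left _)]
      refine (hσ.add (hx.mul_left _)).tsum_le_tsum (fun ξ => ?_) (he'.summable_sq.mul_left K)
      have := hK ξ
      have h6 : 0 ≤ ε * freq ξ ^ 4 := by have := freq_nonneg ξ; positivity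
      rw [mul_pow, sq_abs]
      nlinarith [sq_nonneg ‖e t ξ‖]
    nlinarith [mul_le_mul_of_nonneg_right hdB (add_nonneg hX0 hE0)]

/-! ### The background flow -/

/-- The Fourier coefficients `max (0, 1 - |n| / N)` of the Fejér kernel. -/
def tent (N : ℕ) (n : ℤ) : ℝ := max 0 (1 - |(n : ℝ)| / N)

/-- The Fourier coefficients on `𝕋²` of the Fejér kernel in the variable `x`. -/
def fejer (N : ℕ) (ξ : ℤ × ℤ) : ℝ := if ξ.2 = 0 then tent N ξ.1 else 0

/-- The Fourier coefficients of the background flow, the mean-zero function `φ(x)` with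
`φ' = A (1 - F)`, where `F` is the Fejér kernel of mean `1`. The coefficient at `0` is `0` because
division by zero yields zero. -/
def background (A : ℝ) (N : ℕ) (ξ : ℤ × ℤ) : ℂ :=
  Complex.I * (A : ℂ) * (fejer N ξ : ℂ) / (ξ.1 : ℂ)

theorem tent_nonneg (N : ℕ) (n : ℤ) : 0 ≤ tent N n := le_max_left _ _

theorem tent_le_one (N : ℕ) (n : ℤ) : tent N n ≤ 1 :=
  max_le zero_le_one (by have : 0 ≤ |(n : ℝ)| / N := by positivity
                         linarith)

theorem abs_fejer_le_one (N : ℕ) (ξ : ℤ × ℤ) : |fejer N ξ| ≤ 1 := by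
  unfold fejer
  split_ifs
  · rw [abs_of_nonneg (tent_nonneg _ _)]; exact tent_le_one _ _
  · simp

theorem fejer_zero (N : ℕ) : fejer N 0 = 1 := by
  simp [fejer, tent]

theorem finite_support_fejer {N : ℕ} (hN : 0 < N) : (Function.support (fejer N)).Finite := by
  refine ((Set.finite_Icc (-(N : ℤ)) N).prod (Set.finite_singleton (0 : ℤ))).subset ?_
  intro ξ hξ
  rw [Function.mem_support, fejer] at hξ
  split_ifs at hξ with h
  · refine ⟨?_, h⟩
    have h1 : |(ξ.1 : ℝ)| / N < 1 := by
      by_contra hcon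
      exact hξ (max_eq_left (by linarith))
    rw [div_lt_one (by exact_mod_cast hN)] at h1
    have h2 : |ξ.1| < (N : ℤ) := by exact_mod_cast h1
    exact ⟨(abs_lt.1 h2).1.le, (abs_lt.1 h2).2.le⟩
  · exact absurd rfl hξ

theorem finite_support_background (A : ℝ) {N : ℕ} (hN : 0 < N) :
    (Function.support (background A N)).Finite := by
  refine (finite_support_fejer hN).subset fun ξ hξ h0 => hξ ?_
  rw [background, h0]
  simp

theorem abs_abs_add_sub_abs_sub_le (k j : ℤ) :
    |(|k + j| - |k - j|)| ≤ 2 * (|k| * |j|) := by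
  rcases eq_or_ne j 0 with rfl | hj
  · simp
  rcases eq_or_ne k 0 with rfl | hk
  · simp
  have h1 : 1 ≤ |j| := Int.one_le_abs hj
  have h2 : |(|k + j| - |k - j|)| ≤ 2 * |k| := by
    have h3 := abs_abs_sub_abs_le (k + j) (j - k)
    rw [abs_sub_comm j k, show k + j - (j - k) = 2 * k by ring, abs_mul, abs_two] at h3
    exact h3
  nlinarith [abs_nonneg k]

theorem abs_tent_add_sub_tent_sub_le (N : ℕ) (k j : ℤ) :
    |tent N (k + j) - tent N (k - j)| ≤ 2 * (|(k : ℝ)| * |(j : ℝ)|) / N := by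
  have h : |(|((k + j : ℤ) : ℝ)| - |((k - j : ℤ) : ℝ)|)| ≤ 2 * (|(k : ℝ)| * |(j : ℝ)|) := by
    exact_mod_cast abs_abs_add_sub_abs_sub_le k j
  have hm := abs_max_sub_max_le_abs (1 - |((k + j : ℤ) : ℝ)| / N) (1 - |((k - j : ℤ) : ℝ)| / N) 0
  unfold tent
  rw [max_comm, max_comm 0]
  refine hm.trans ?_
  rw [sub_sub_sub_cancel_left, ← sub_div, abs_div, abs_sub_comm, Nat.abs_cast]
  gcongr

/-- Summing over pairs with opposite second components. -/
theorem hasSum_slice {x : ℤ × ℤ → ℝ} {y : ℤ → ℝ} (hx : Summable x) (hy : Summable y)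
    (hx0 : ∀ ξ, 0 ≤ x ξ) (hy0 : ∀ n, 0 ≤ y n) :
    HasSum (fun p : (ℤ × ℤ) × (ℤ × ℤ) => if p.1.2 + p.2.2 = 0 then x p.1 * y p.2.1 else 0)
      ((∑' ξ, x ξ) * ∑' n, y n) := by
  have h := hx.hasSum.mul hy.hasSum (Summable.mul_of_nonneg hx hy hx0 hy0)
  let g : (ℤ × ℤ) × ℤ → (ℤ × ℤ) × (ℤ × ℤ) := fun q => (q.1, (q.2, -q.1.2))
  have hg : Function.Injective g := fun q q' hq =>
    Prod.ext (congrArg (fun p => p.1) hq) (congrArg (fun p => p.2.1) hq)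
  refine (hg.hasSum_iff (f := fun p : (ℤ × ℤ) × (ℤ × ℤ) =>
    if p.1.2 + p.2.2 = 0 then x p.1 * y p.2.1 else 0) ?_).1 ?_
  · intro p hp
    refine if_neg fun h0 => hp ⟨(p.1, p.2.1), ?_⟩
    refine Prod.ext rfl (Prod.ext rfl ?_)
    change -p.1.2 = p.2.2
    linarith
  · have hval : ∀ q : (ℤ × ℤ) × ℤ, (if (g q).1.2 + (g q).2.2 = 0 then
        x (g q).1 * y (g q).2.1 else 0) = x q.1 * y q.2 := fun q =>
      if_pos (show q.1.2 + -q.1.2 = 0 by ring)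
    exact HasSum.congr_fun h hval

/-- The mean of `η² F` for odd `η`: since `η` vanishes on the line `x = 0`, where the Fejér kernel
`F` concentrates, it is `O(1 / N)` relative to the `H²` norm. On the Fourier side, oddness turns the
coefficient of `F` at `ζ₁ + η₁` into half its difference with the one at `ζ₁ - η₁`. -/
theorem norm_tsum_fejer_mul_conv_le {C : ℝ} {a : ℤ × ℤ → ℂ} (ha : H2Le C a)
    (hodd : ∀ ξ, a (reflX ξ) = -a ξ) (N : ℕ) :
    Summable (fun ξ => (fejer N ξ : ℂ) * conv a a ξ) ∧
    ‖∑' ξ, (fejer N ξ : ℂ) * conv a a ξ‖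
      ≤ (∑' n : ℤ, ((n : ℝ) ^ 2)⁻¹) / N * ∑' ξ : ℤ × ℤ, (ξ.1 : ℝ) ^ 4 * ‖a ξ‖ ^ 2 := by
  have hx4 : ∀ ξ : ℤ × ℤ, |(ξ.1 : ℝ) ^ 4| ≤ 1 * wt ξ ^ 2 := fun ξ => by
    rw [abs_of_nonneg (by positivity), one_mul, wt, freq_sq]
    nlinarith [sq_nonneg (ξ.1 : ℝ), sq_nonneg (ξ.2 : ℝ), sq_nonneg ((ξ.2 : ℝ) ^ 2),
      mul_nonneg (sq_nonneg (ξ.1 : ℝ)) (sq_nonneg (ξ.2 : ℝ))]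
  have hX := ha.summable_mul_sq 1 hx4
  have hY : Summable (fun n : ℤ => ((n : ℝ) ^ 2)⁻¹) := by
    simpa using Real.summable_one_div_int_pow.2 one_lt_two
  set f : (ℤ × ℤ) × (ℤ × ℤ) → ℂ := fun p => (fejer N (p.1 + p.2) : ℂ) * (a p.1 * a p.2) with hf
  have hfs : Summable f := by
    refine Summable.of_norm_bounded (summable_norm_mul_norm ha.summable_norm ha.summable_norm)
      fun p => ?_
    simp only [hf, norm_mul, Complex.norm_real]
    exact mul_le_of_le_one_left (by positivity) (abs_fejer_le_one N _)
  -- The sum over `ξ` of the convolution is a sum over all pairs of frequencies.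
  have hpair : Summable (fun ξ => (fejer N ξ : ℂ) * conv a a ξ) ∧
      ∑' ξ, (fejer N ξ : ℂ) * conv a a ξ = ∑' p, f p := by
    have hs : Summable (fun p => f (shear p)) := (shear.summable_iff (f := f)).2 hfs
    have hin : ∀ ξ, ∑' ζ, f (shear (ξ, ζ)) = (fejer N ξ : ℂ) * conv a a ξ := fun ξ => by
      rw [conv, ← tsum_mul_left]
      refine tsum_congr fun ζ => ?_
      simp [hf, shear]
    have h1 := hs.prod
    have h2 := hs.tsum_prod
    simp only [hin] at h1 h2
    exact ⟨h1, h2.symm.trans (shear.tsum_eq f)⟩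
  refine ⟨hpair.1, ?_⟩
  rw [hpair.2]
  let e : (ℤ × ℤ) × (ℤ × ℤ) ≃ (ℤ × ℤ) × (ℤ × ℤ) := (Equiv.refl _).prodCongr reflX
  have hes : Summable (fun p => f (e p)) := (e.summable_iff (f := f)).2 hfs
  have hhalf : ∑' p, f p = ∑' p, (f p + f (e p)) / 2 := by
    have h1 : ∑' p, f (e p) = ∑' p, f p := e.tsum_eq f
    rw [tsum_div_const, hfs.tsum_add hes, h1]
    ring
  have hS := hasSum_slice hX hY (fun ξ => by positivity) (fun n => by positivity)
  have hS' := ((Equiv.prodComm (ℤ × ℤ) (ℤ × ℤ)).hasSum_iff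
    (f := fun p : (ℤ × ℤ) × (ℤ × ℤ) => if p.1.2 + p.2.2 = 0 then
      (p.1.1 : ℝ) ^ 4 * ‖a p.1‖ ^ 2 * ((p.2.1 : ℝ) ^ 2)⁻¹ else 0)).2 hS
  have hM := (hS.add hS').mul_left (1 / (2 * (N : ℝ)))
  rw [hhalf]
  refine (tsum_of_norm_bounded hM fun p => ?_).trans_eq ?_
  · have hval : (f p + f (e p)) / 2
        = ((fejer N (p.1 + p.2) - fejer N (p.1 + reflX p.2) : ℝ) : ℂ) / 2 * (a p.1 * a p.2) := by
      simp only [hf, e, Equiv.prodCongr_apply, Prod.map, Equiv.refl_apply, hodd]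
      push_cast
      ring
    rw [hval]
    simp only [Function.comp_apply, Equiv.prodComm_apply, Prod.fst_swap, Prod.snd_swap,
      fejer, Prod.snd_add, Prod.fst_add, reflX_apply, add_comm p.2.2 p.1.2]
    by_cases h0 : p.1.2 + p.2.2 = 0
    · simp only [h0, if_true]
      rw [← sub_eq_add_neg, norm_mul, norm_div, Complex.norm_real, Real.norm_eq_abs,
        Complex.norm_ofNat, norm_mul]
      have ht := abs_tent_add_sub_tent_sub_le N p.1.1 p.2.1
      set k : ℝ := (p.1.1 : ℝ) with hk
      set j : ℝ := (p.2.1 : ℝ) with hj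
      calc _ ≤ 2 * (|k| * |j|) / N / 2 * (‖a p.1‖ * ‖a p.2‖) := by gcongr
        _ = (1 / (2 * (N : ℝ))) * (2 * ((|k| * ‖a p.1‖) * (|j| * ‖a p.2‖))) := by
            by_cases hN : (N : ℝ) = 0
            · simp [hN]
            · field_simp
        _ ≤ _ := by
            refine mul_le_mul_of_nonneg_left ?_ (by positivity)
            by_cases hk0 : k = 0
            · rw [hk0]; simp
            by_cases hj0 : j = 0
            · rw [hj0]; simp
            have hsq : 0 ≤ (k ^ 2 * ‖a p.1‖ / |j| - j ^ 2 * ‖a p.2‖ / |k|) ^ 2 := sq_nonneg _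
            have hka : |k| ≠ 0 := abs_ne_zero.2 hk0
            have hja : |j| ≠ 0 := abs_ne_zero.2 hj0
            have hid : (k ^ 2 * ‖a p.1‖ / |j| - j ^ 2 * ‖a p.2‖ / |k|) ^ 2
                = k ^ 4 * ‖a p.1‖ ^ 2 * (j ^ 2)⁻¹ + j ^ 4 * ‖a p.2‖ ^ 2 * (k ^ 2)⁻¹
                  - 2 * ((|k| * ‖a p.1‖) * (|j| * ‖a p.2‖)) := by
              rw [← sq_abs k, ← sq_abs j, ← Even.pow_abs (by decide : Even 4) k,
                ← Even.pow_abs (by decide : Even 4) j]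
              field_simp
              ring
            linarith
    · simp [h0]
  · by_cases hN : (N : ℝ) = 0
    · simp [hN]
    · field_simp
      ring

theorem conv_self_zero {a : ℤ × ℤ → ℂ} (hreal : ∀ ξ, a (-ξ) = conj (a ξ)) :
    conv a a 0 = ((∑' ξ, ‖a ξ‖ ^ 2 : ℝ) : ℂ) := by
  rw [conv, Complex.ofReal_tsum]
  refine tsum_congr fun ξ => ?_
  rw [zero_sub, hreal, Complex.mul_conj, Complex.normSq_eq_norm_sq]

/-- The work of the convection term against the background flow. -/
theorem inner_background (A : ℝ) (N : ℕ) (ξ : ℤ × ℤ) (c : ℂ) :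
    inner ℝ (background A N ξ) (Complex.I * (ξ.1 : ℂ) * c)
      = A * (fejer N ξ * c.re - if ξ = 0 then c.re else 0) := by
  rw [Complex.inner, background]
  simp only [map_div₀, map_mul, Complex.conj_I, Complex.conj_ofReal, map_intCast]
  by_cases h1 : ξ.1 = 0
  · have : fejer N ξ * c.re = if ξ = 0 then c.re else 0 := by
      by_cases h2 : ξ.2 = 0
      · have : ξ = 0 := Prod.ext h1 h2
        subst this
        simp [fejer_zero]
      · rw [if_neg (fun h => h2 (by rw [h]; rfl)), fejer, if_neg h2, zero_mul]
    rw [this, h1]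
    simp
  · have h0 : ξ ≠ 0 := fun h => h1 (by rw [h]; rfl)
    have hc : (ξ.1 : ℂ) ≠ 0 := by exact_mod_cast h1
    rw [if_neg h0, sub_zero]
    have : Complex.I * (ξ.1 : ℂ) * c * (-Complex.I * (A : ℂ) * (fejer N ξ : ℂ) / (ξ.1 : ℂ))
        = ((A * fejer N ξ : ℝ) : ℂ) * c := by
      field_simp
      push_cast
      linear_combination (-(A : ℂ) * (fejer N ξ : ℂ) * c) * Complex.I_sq
    rw [this, Complex.re_ofReal_mul]
    ring

/-- The differential inequality for the distance to a suitable background flow `φ`. -/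
theorem exists_background (β δ : ℝ) {ε : ℝ} (hε : 0 < ε) :
    ∃ φ : ℤ × ℤ → ℂ, (Function.support φ).Finite ∧ ∃ D : ℝ, 0 ≤ D ∧
      ∀ (C : ℝ) (a : ℤ × ℤ → ℂ), H2Le C a → (∀ ξ, a (-ξ) = conj (a ξ)) →
        (∀ ξ, a (reflX ξ) = -a ξ) →
        ∑' ξ, 2 * inner ℝ (a ξ - φ ξ) (rate β δ ε a ξ)
          ≤ -(1 / 2) * ∑' ξ, ‖a ξ - φ ξ‖ ^ 2 + D := by
  obtain ⟨K, hK0, hK⟩ := exists_two_mul_symb_le β δ hε 0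
  set Y := ∑' n : ℤ, ((n : ℝ) ^ 2)⁻¹ with hY
  have hY0 : 0 ≤ Y := tsum_nonneg fun _ => by positivity
  -- `A` beats the linear growth rate `K`, and then `N` makes the Fejér term smaller than the
  -- dissipation.
  set A := K + 2 with hA
  obtain ⟨N, hN⟩ := exists_nat_gt (A * Y / ε)
  have hN0 : (0 : ℝ) < N := lt_of_le_of_lt (by positivity) hN
  have hNε : A * (Y / N) ≤ ε := by
    rw [div_lt_iff₀ hε] at hN
    rw [← mul_div_assoc, div_le_iff₀ hN0]
    linarith
  set φ := background A N with hφ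
  have hfin := finite_support_background A (N := N) (by exact_mod_cast hN0)
  have hφs : ∀ c : ℤ × ℤ → ℝ, Summable (fun ξ => c ξ * ‖φ ξ‖ ^ 2) := fun c =>
    summable_of_hasFiniteSupport (hfin.subset fun ξ hξ h0 => hξ (by simp [hφ, h0]))
  have hφ2 : Summable (fun ξ => ‖φ ξ‖ ^ 2) := by simpa using hφs fun _ => 1
  set P := ∑' ξ, symb β δ ε ξ ^ 2 * ‖φ ξ‖ ^ 2 with hP
  set Q := ∑' ξ, ‖φ ξ‖ ^ 2 with hQ
  refine ⟨φ, hfin, P + Q, add_nonneg (tsum_nonneg fun _ => by positivity)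
    (tsum_nonneg fun _ => by positivity), fun C a ha hreal hodd => ?_⟩
  have hr4 : Summable (fun ξ => freq ξ ^ 4 * ‖a ξ‖ ^ 2) := ha.summable_mul_sq 1 fun ξ => by
    have := freq_nonneg ξ
    rw [abs_of_nonneg (by positivity), one_mul, wt]
    nlinarith [sq_nonneg (freq ξ)]
  have hx4 : Summable (fun ξ : ℤ × ℤ => (ξ.1 : ℝ) ^ 4 * ‖a ξ‖ ^ 2) := by
    refine hr4.of_nonneg_of_le (fun ξ => by positivity) fun ξ => ?_
    exact mul_le_mul_of_nonneg_right (fst_pow_four_le ξ) (sq_nonneg _)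
  have hx4r : ∑' ξ : ℤ × ℤ, (ξ.1 : ℝ) ^ 4 * ‖a ξ‖ ^ 2 ≤ ∑' ξ, freq ξ ^ 4 * ‖a ξ‖ ^ 2 := by
    refine hx4.tsum_le_tsum (fun ξ => ?_) hr4
    exact mul_le_mul_of_nonneg_right (fst_pow_four_le ξ) (sq_nonneg _)
  have ha2 := ha.summable_sq
  set S := ∑' ξ, ‖a ξ‖ ^ 2 with hS
  set R4 := ∑' ξ, freq ξ ^ 4 * ‖a ξ‖ ^ 2 with hR4
  -- The convection term does no work on `a`.
  have hcan : HasSum (fun ξ : ℤ × ℤ => inner ℝ (a ξ) (Complex.I * (ξ.1 : ℂ) * conv a a ξ)) 0 := by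
    have h := (Complex.hasSum_im (hasSum_conj_mul_fst_mul_conv ha hreal)).neg
    rw [Complex.zero_im, neg_zero] at h
    convert! h using 2 with ξ
    rw [Complex.inner, ← Complex.I_mul_re]
    congr 1
    ring
  obtain ⟨hF1, hF2⟩ := norm_tsum_fejer_mul_conv_le ha hodd N
  have hbg : HasSum
      (fun ξ : ℤ × ℤ => inner ℝ (φ ξ) (Complex.I * (ξ.1 : ℂ) * conv a a ξ))
      (A * ((∑' ξ, (fejer N ξ : ℂ) * conv a a ξ).re - S)) := by
    have h1 := Complex.hasSum_re hF1.hasSum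
    have h2 : HasSum (fun ξ : ℤ × ℤ => if ξ = 0 then (conv a a ξ).re else 0) S := by
      have := hasSum_ite_eq (0 : ℤ × ℤ) (conv a a 0).re
      rw [conv_self_zero hreal, Complex.ofReal_re] at this
      convert! this using 2 with ξ
      split_ifs with h
      · rw [h, conv_self_zero hreal, Complex.ofReal_re]
      · rfl
    have h3 := (h1.sub h2).mul_left A
    convert! h3 using 2 with ξ
    rw [hφ, inner_background, Complex.re_ofReal_mul]
  have hbg_le : A * ((∑' ξ, (fejer N ξ : ℂ) * conv a a ξ).re - S) ≤ ε * R4 - A * S := by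
    have h1 := (Complex.re_le_norm _).trans hF2
    have hX0 : 0 ≤ ∑' ξ : ℤ × ℤ, (ξ.1 : ℝ) ^ 4 * ‖a ξ‖ ^ 2 := tsum_nonneg fun _ => by positivity
    have hA0 : 0 ≤ A := by linarith
    have h2 := mul_le_mul_of_nonneg_left h1 hA0
    rw [← mul_assoc] at h2
    have h3 := h2.trans (mul_le_mul hNε hx4r hX0 hε.le)
    linarith
  -- The linear terms, with the cross term absorbed by Young's inequality.
  have hmaj : HasSum (fun ξ => (K + 1) * ‖a ξ‖ ^ 2 - ε * (freq ξ ^ 4 * ‖a ξ‖ ^ 2)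
      + symb β δ ε ξ ^ 2 * ‖φ ξ‖ ^ 2) ((K + 1) * S - ε * R4 + P) :=
    ((ha2.hasSum.mul_left (K + 1)).sub (hr4.hasSum.mul_left ε)).add (hφs _).hasSum
  have hle : ∀ ξ, 2 * inner ℝ (a ξ - φ ξ) (rate β δ ε a ξ)
      ≤ (K + 1) * ‖a ξ‖ ^ 2 - ε * (freq ξ ^ 4 * ‖a ξ‖ ^ 2) + symb β δ ε ξ ^ 2 * ‖φ ξ‖ ^ 2
        - inner ℝ (a ξ) (Complex.I * (ξ.1 : ℂ) * conv a a ξ)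
        + inner ℝ (φ ξ) (Complex.I * (ξ.1 : ℂ) * conv a a ξ) := by
    intro ξ
    have hrate : rate β δ ε a ξ = (symb β δ ε ξ) • a ξ
        - (1 / 2 : ℝ) • (Complex.I * (ξ.1 : ℂ) * conv a a ξ) := by
      rw [rate, Complex.real_smul, Complex.real_smul]
      push_cast
      ring
    rw [hrate, inner_sub_left, inner_sub_right, inner_sub_right]
    simp only [inner_smul_right, real_inner_self_eq_norm_sq]
    have h1 : -(2 * (symb β δ ε ξ * inner ℝ (φ ξ) (a ξ)))
        ≤ ‖a ξ‖ ^ 2 + symb β δ ε ξ ^ 2 * ‖φ ξ‖ ^ 2 := by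
      have h2 := neg_le_abs (symb β δ ε ξ * inner ℝ (φ ξ) (a ξ))
      rw [abs_mul] at h2
      have h3 := mul_le_mul_of_nonneg_left (abs_real_inner_le_norm (φ ξ) (a ξ))
        (abs_nonneg (symb β δ ε ξ))
      have h4 := sq_nonneg (‖a ξ‖ - |symb β δ ε ξ| * ‖φ ξ‖)
      have h5 := sq_abs (symb β δ ε ξ)
      rw [← h5]
      nlinarith
    have h6 := hK ξ
    have h7 : 2 * symb β δ ε ξ * ‖a ξ‖ ^ 2 ≤ (K - ε * freq ξ ^ 4) * ‖a ξ‖ ^ 2 :=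
      mul_le_mul_of_nonneg_right (by linarith) (sq_nonneg _)
    linarith
  have htot := (hmaj.sub hcan).add hbg
  have hkey : ∑' ξ, 2 * inner ℝ (a ξ - φ ξ) (rate β δ ε a ξ) ≤ -S + P := by
    have hs : Summable (fun ξ => 2 * inner ℝ (a ξ - φ ξ) (rate β δ ε a ξ)) := by
      have hφC : H2Le (∑' ξ, wt ξ ^ 2 * ‖φ ξ‖ ^ 2) φ := ⟨hφs _, le_rfl⟩
      have hC0 := ha.nonneg
      have hφ0 := hφC.nonneg
      have ha' : H2Le (2 * (C + ∑' ξ, wt ξ ^ 2 * ‖φ ξ‖ ^ 2)) a := ha.mono (by linarith)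
      obtain ⟨C', hC'⟩ := exists_bound_pairing β δ ε (2 * (C + ∑' ξ, wt ξ ^ 2 * ‖φ ξ‖ ^ 2))
      refine Summable.of_norm_bounded
        ((hC' _ _ _ _ (ha.sub hφC) ha' ha' ha').1.mul_left 2) fun ξ => ?_
      rw [Real.norm_eq_abs, abs_mul, abs_two]
      exact mul_le_mul_of_nonneg_left (abs_real_inner_le_norm _ _) two_pos.le
    refine (hs.tsum_le_tsum hle htot.summable).trans ?_
    rw [htot.tsum_eq]
    linarith
  have hdist : ∑' ξ, ‖a ξ - φ ξ‖ ^ 2 ≤ 2 * S + 2 * Q := by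
    have hle2 : ∀ ξ, ‖a ξ - φ ξ‖ ^ 2 ≤ 2 * ‖a ξ‖ ^ 2 + 2 * ‖φ ξ‖ ^ 2 := fun ξ => by
      have := pow_le_pow_left₀ (norm_nonneg _) (norm_sub_le (a ξ) (φ ξ)) 2
      nlinarith [sq_nonneg (‖a ξ‖ - ‖φ ξ‖)]
    have hs2 := (ha2.mul_left 2).add (hφ2.mul_left 2)
    refine ((hs2.of_nonneg_of_le (fun _ => sq_nonneg _) hle2).tsum_le_tsum hle2 hs2).trans_eq ?_
    rw [(ha2.mul_left 2).tsum_add (hφ2.mul_left 2), tsum_mul_left, tsum_mul_left]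
  linarith

/-! ### Fourier coefficients of real square-integrable functions -/

/-- The Fourier coefficients of an element of `L²(𝕋²)`. -/
def modes (u : L2) (ξ : ℤ × ℤ) : ℂ := coeff (fun p => ((u p : ℝ) : ℂ)) ξ

theorem memLp_ofReal (u : L2) : MemLp (fun p => ((u p : ℝ) : ℂ)) 2 (volume : Measure T2) :=
  (Lp.memLp u).ofReal

theorem memLp_expo_mul (ξ : ℤ × ℤ) {f : T2 → ℂ} (hf : MemLp f 2) :
    MemLp (fun p => expo ξ p * f p) 2 :=
  hf.of_le ((continuous_expo ξ).aestronglyMeasurable.mul hf.1)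
    (.of_forall fun p => by rw [norm_mul, norm_expo, one_mul])

theorem integrable_expo_mul (u : L2) (ξ : ℤ × ℤ) :
    Integrable (fun p => expo ξ p * ((u p : ℝ) : ℂ)) :=
  (memLp_expo_mul ξ (memLp_ofReal u)).integrable one_le_two

theorem modes_neg (u : L2) (ξ : ℤ × ℤ) : modes u (-ξ) = conj (modes u ξ) := by
  rw [modes, modes, coeff, coeff, map_mul, Complex.conj_ofReal, ← integral_conj]
  congr 1
  refine integral_congr_ae (.of_forall fun p => ?_)
  simp only [map_mul, Complex.conj_ofReal]
  rw [expo_neg]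

theorem modes_sub (u v : L2) (ξ : ℤ × ℤ) : modes (u - v) ξ = modes u ξ - modes v ξ := by
  simp only [modes, coeff]
  rw [← mul_sub, ← integral_sub (integrable_expo_mul u _) (integrable_expo_mul v _)]
  congr 1
  apply integral_congr_ae
  filter_upwards [Lp.coeFn_sub u v] with p hp
  rw [hp, Pi.sub_apply]
  push_cast
  ring

theorem norm_sq_eq_tsum_modes (u : L2) : ‖u‖ ^ 2 = (2 * Real.pi) ^ 2 * ∑' ξ, ‖modes u ξ‖ ^ 2 := by
  have h := hasSum_coeff_mul_coeff (memLp_ofReal u) (memLp_ofReal u)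
  have h1 : ∫ p, conj ((u p : ℝ) : ℂ) * ((u p : ℝ) : ℂ) = ((‖u‖ ^ 2 : ℝ) : ℂ) := by
    rw [← real_inner_self_eq_norm_sq, L2.inner_def, ← integral_complex_ofReal]
    refine integral_congr_ae (.of_forall fun p => ?_)
    simp [sq]
  rw [h1, ← Complex.ofReal_mul] at h
  have h2 : HasSum (fun ξ => ‖modes u ξ‖ ^ 2) (((2 * Real.pi) ^ 2)⁻¹ * ‖u‖ ^ 2) := by
    rw [← Complex.hasSum_ofReal]
    refine HasSum.congr_fun h fun ξ => ?_
    rw [Complex.conj_mul', modes]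
    push_cast
    rfl
  rw [h2.tsum_eq, mul_inv_cancel_left₀]
  have := Real.two_pi_pos
  positivity

theorem coeff_expo_mul (f : T2 → ℂ) (ξ ζ : ℤ × ℤ) :
    coeff (fun p => expo ξ p * f p) ζ = coeff f (ζ - ξ) := by
  rw [coeff, coeff]
  congr 1
  refine integral_congr_ae (.of_forall fun p => ?_)
  change expo (-ζ) p * (expo ξ p * f p) = expo (-(ζ - ξ)) p * f p
  rw [neg_sub, sub_eq_add_neg, expo_add]
  ring

/-- The Fourier coefficients of `u²` are given by the convolution. -/
theorem integral_expo_mul_sq (u : L2) (ξ : ℤ × ℤ) :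
    ((((2 * Real.pi) ^ 2)⁻¹ : ℝ) : ℂ) * ∫ p, expo (-ξ) p * ((u p : ℝ) : ℂ) ^ 2
      = conv (modes u) (modes u) ξ := by
  have h := hasSum_coeff_mul_coeff (memLp_expo_mul ξ (memLp_ofReal u)) (memLp_ofReal u)
  have h1 : ∫ p, conj (expo ξ p * ((u p : ℝ) : ℂ)) * ((u p : ℝ) : ℂ)
      = ∫ p, expo (-ξ) p * ((u p : ℝ) : ℂ) ^ 2 := by
    refine integral_congr_ae (.of_forall fun p => ?_)
    simp only [map_mul, Complex.conj_ofReal, expo_neg]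
    ring
  rw [h1] at h
  rw [← h.tsum_eq, conv_comm, conv]
  rw [← (Equiv.subLeft ξ).tsum_eq (fun ζ => modes u ζ * modes u (ξ - ζ))]
  refine tsum_congr fun ζ => ?_
  rw [coeff_expo_mul]
  simp only [Equiv.subLeft_apply, sub_sub_cancel]
  rw [← neg_sub ζ ξ, modes_neg]
  rfl

theorem modes_reflX {u : L2} (hu : OddInX u) (ξ : ℤ × ℤ) : modes u (reflX ξ) = -modes u ξ := by
  let e : T2 ≃ᵐ T2 := (MeasurableEquiv.neg T1).prodCongr (MeasurableEquiv.refl T1)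
  have he : MeasurePreserving e (volume : Measure T2) volume :=
    (Measure.measurePreserving_neg (volume : Measure T1)).prod (MeasurePreserving.id _)
  rw [modes, modes, coeff, coeff, ← he.integral_comp', ← mul_neg, ← integral_neg]
  congr 1
  apply integral_congr_ae
  filter_upwards [hu] with p hp
  have h1 : expo (-reflX ξ) (e p) = expo (-ξ) p := by
    change fourier (-(-ξ.1)) (-p.1) * fourier (-ξ.2) p.2 = fourier (-ξ.1) p.1 * fourier (-ξ.2) p.2
    congr 1
    simp [fourier_apply]
  have h2 : u (e p) = -u p := hp
  rw [h1, h2]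
  push_cast
  ring

theorem sobolevSq_eq (s : ℕ) (u : L2) :
    sobolevSq s u = ∑' ξ, ENNReal.ofReal (wt ξ ^ s * ‖modes u ξ‖ ^ 2) := rfl

theorem H2Le_of_sobolevSq_le {u : L2} {C : ℝ} (hC : 0 ≤ C) (h : sobolevSq 2 u ≤ ENNReal.ofReal C) :
    H2Le C (modes u) := by
  rw [sobolevSq_eq] at h
  have h0 : ∀ ξ, 0 ≤ wt ξ ^ 2 * ‖modes u ξ‖ ^ 2 := fun ξ => by positivity
  have hs : Summable (fun ξ => wt ξ ^ 2 * ‖modes u ξ‖ ^ 2) := by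
    have := ENNReal.summable_toReal (ne_top_of_le_ne_top ENNReal.ofReal_ne_top h)
    simpa only [ENNReal.toReal_ofReal (h0 _)] using this
  refine ⟨hs, ?_⟩
  rw [← ENNReal.ofReal_tsum_of_nonneg h0 hs] at h
  exact (ENNReal.ofReal_le_ofReal_iff hC).1 h

theorem sobolevSq_le_add (u v : L2) :
    sobolevSq 2 u ≤ 2 * sobolevSq 2 (u - v) + 2 * sobolevSq 2 v := by
  simp only [sobolevSq_eq]
  rw [← ENNReal.tsum_mul_left, ← ENNReal.tsum_mul_left, ← ENNReal.tsum_add]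
  refine ENNReal.tsum_le_tsum fun ξ => ?_
  have htwo : ∀ x : ℝ, 2 * ENNReal.ofReal x = ENNReal.ofReal (2 * x) := fun x => by
    rw [ENNReal.ofReal_mul two_pos.le, ENNReal.ofReal_ofNat]
  rw [htwo, htwo, ← ENNReal.ofReal_add (by positivity) (by positivity)]
  refine ENNReal.ofReal_le_ofReal ?_
  rw [modes_sub]
  have h1 : ‖modes u ξ‖ ≤ ‖modes u ξ - modes v ξ‖ + ‖modes v ξ‖ := by
    simpa using norm_add_le (modes u ξ - modes v ξ) (modes v ξ)
  have h2 := pow_le_pow_left₀ (norm_nonneg _) h1 2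
  have h3 : ‖modes u ξ‖ ^ 2 ≤ 2 * (‖modes u ξ - modes v ξ‖ ^ 2 + ‖modes v ξ‖ ^ 2) := by
    nlinarith [sq_nonneg (‖modes u ξ - modes v ξ‖ - ‖modes v ξ‖)]
  nlinarith [mul_le_mul_of_nonneg_left h3 (sq_nonneg (wt ξ))]

/-! ### Testing the equation with characters -/

theorem coeff_expo (ξ ζ : ℤ × ℤ) : coeff (expo ξ) ζ = if ζ = ξ then 1 else 0 := by
  have h : ∀ p, expo (-ζ) p * expo ξ p = expo (ξ - ζ) p := fun p => by
    rw [sub_eq_add_neg, expo_add, mul_comm]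
  simp only [coeff, h, integral_expo, sub_eq_zero, eq_comm (a := ξ)]
  split_ifs
  · rw [← Complex.ofReal_mul, inv_mul_cancel₀, Complex.ofReal_one]
    have := Real.two_pi_pos
    positivity
  · simp

theorem hasDerivAt_fourier_translate (n : ℤ) (x : T1) :
    HasDerivAt (fun h : ℝ => fourier n (x + (h : T1))) (Complex.I * (n : ℂ) * fourier n x) 0 := by
  have h1 := (hasDerivAt_fourier (2 * Real.pi) n 0).const_mul (fourier n x)
  have h2 : ∀ h : ℝ, fourier n (x + (h : T1)) = fourier n x * fourier n (h : T1) := fun h => by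
    simp [fourier_apply, smul_add, AddCircle.toCircle_add]
  simp only [h2]
  convert! h1 using 1
  have hpi : (Real.pi : ℂ) ≠ 0 := by exact_mod_cast Real.pi_ne_zero
  rw [QuotientAddGroup.mk_zero, fourier_eval_zero]
  push_cast
  field_simp

theorem dx_mul_expo (c : ℂ) (ξ : ℤ × ℤ) :
    dx (fun p => c * expo ξ p) = fun p => c * (Complex.I * (ξ.1 : ℂ)) * expo ξ p := by
  funext p
  have h := ((hasDerivAt_fourier_translate ξ.1 p.1).mul_const (fourier ξ.2 p.2)).const_mul c
  rw [dx]
  refine Eq.trans h.deriv ?_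
  rw [expo]
  ring

theorem dy_mul_expo (c : ℂ) (ξ : ℤ × ℤ) :
    dy (fun p => c * expo ξ p) = fun p => c * (Complex.I * (ξ.2 : ℂ)) * expo ξ p := by
  funext p
  have h := ((hasDerivAt_fourier_translate ξ.2 p.2).const_mul (fourier ξ.1 p.1)).const_mul c
  rw [dy]
  refine Eq.trans h.deriv ?_
  rw [expo]
  ring

theorem lap_mul_expo (c : ℂ) (ξ : ℤ × ℤ) :
    lap (fun p => c * expo ξ p) = fun p => c * (-(freq ξ ^ 2 : ℝ) : ℂ) * expo ξ p := by
  funext p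
  rw [lap, dx_mul_expo, dx_mul_expo, dy_mul_expo, dy_mul_expo, freq_sq]
  push_cast
  linear_combination (c * ((ξ.1 : ℂ) ^ 2 + (ξ.2 : ℂ) ^ 2) * expo ξ p) * Complex.I_sq

theorem lambdaCubed_expo (ξ : ℤ × ℤ) (p : T2) :
    lambdaCubed (expo ξ) p = ((freq ξ ^ 3 : ℝ) : ℂ) * expo ξ p := by
  rw [lambdaCubed, tsum_eq_single ξ]
  · rw [coeff_expo, if_pos rfl, mul_one]
  · intro ζ hζ
    rw [coeff_expo, if_neg hζ, mul_zero, zero_mul]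

theorem isTest_expo (ξ : ℤ × ℤ) : IsTest (expo ξ) := by
  have h : ∀ n : ℤ, ContDiff ℝ ∞ (fun x : ℝ => (fourier n (x : T1) : ℂ)) := fun n => by
    simp only [fourier_coe_apply]
    exact Complex.contDiff_exp.comp (((contDiff_const.mul
      Complex.ofRealCLM.contDiff)).div_const _)
  exact ((h ξ.1).comp contDiff_fst).mul ((h ξ.2).comp contDiff_snd)

theorem weakRHS_expo (β δ ε : ℝ) (u : L2) (ξ : ℤ × ℤ) :
    ((((2 * Real.pi) ^ 2)⁻¹ : ℝ) : ℂ) * weakRHS β δ ε u (expo (-ξ))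
      = rate β δ ε (modes u) ξ := by
  have e1 : expo (-ξ) = fun p => 1 * expo (-ξ) p := by simp
  have hdx : dx (expo (-ξ)) = fun p => 1 * (Complex.I * ((-ξ).1 : ℂ)) * expo (-ξ) p := by
    rw [e1, dx_mul_expo]; simp
  have hdy : dy (expo (-ξ)) = fun p => 1 * (Complex.I * ((-ξ).2 : ℂ)) * expo (-ξ) p := by
    rw [e1, dy_mul_expo]; simp
  have hlap : lap (expo (-ξ)) = fun p => 1 * (-(freq (-ξ) ^ 2 : ℝ) : ℂ) * expo (-ξ) p := by
    rw [e1, lap_mul_expo]; simp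
  have hf : freq (-ξ) = freq ξ := by simp [freq]
  have hint : ∀ p, (1 / 2 : ℂ) * ((u p : ℝ) : ℂ) ^ 2 * dx (expo (-ξ)) p
      + ((u p : ℝ) : ℂ) *
        (-((β : ℂ) - 1) * dx (dx (expo (-ξ))) p + dy (dy (expo (-ξ))) p
          + (δ : ℂ) * lambdaCubed (expo (-ξ)) p - (ε : ℂ) * lap (lap (expo (-ξ))) p)
      = -(Complex.I * (ξ.1 : ℂ) / 2) * (expo (-ξ) p * ((u p : ℝ) : ℂ) ^ 2)
        + (symb β δ ε ξ : ℂ) * (expo (-ξ) p * ((u p : ℝ) : ℂ)) := by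
    intro p
    rw [hdx, hdy, hlap, dx_mul_expo, dy_mul_expo, lap_mul_expo, lambdaCubed_expo, hf, symb]
    push_cast
    simp only [Prod.fst_neg, Prod.snd_neg, Int.cast_neg]
    linear_combination ((u p : ℂ) * expo (-ξ) p *
      (-((β : ℂ) - 1) * (ξ.1 : ℂ) ^ 2 + (ξ.2 : ℂ) ^ 2)) * Complex.I_sq
  have hsq : Integrable (fun p => expo (-ξ) p * ((u p : ℝ) : ℂ) ^ 2) := by
    have := (memLp_expo_mul (-ξ) (memLp_ofReal u)).integrable_mul (memLp_ofReal u)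
    refine this.congr (.of_forall fun p => ?_)
    simp only [Pi.mul_apply]
    ring
  rw [weakRHS]
  simp only [hint]
  rw [integral_add (hsq.const_mul _) ((integrable_expo_mul u _).const_mul _),
    integral_const_mul, integral_const_mul, rate, ← integral_expo_mul_sq, modes, coeff]
  ring

/-! ### Solutions as mode flows -/

theorem IsSolution.exists_isModeFlow {β δ ε : ℝ} {η₀ : L2} {η : ℝ → L2}
    (h : IsSolution β δ ε η₀ η) (T : ℝ) :
    ∃ C, IsModeFlow β δ ε T C (fun t => modes (η t)) := by
  have hsub : Set.Icc 0 T ⊆ Set.Ici (0 : ℝ) := Set.Icc_subset_Ici_self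
  have hbd : ∃ C : NNReal, ∀ t ∈ Set.Icc 0 T, sobolevSq 2 (η t) ≤ C := by
    refine isCompact_Icc.induction_on (p := fun s => ∃ C : NNReal, ∀ t ∈ s, sobolevSq 2 (η t) ≤ C)
      ⟨0, by simp⟩ (fun s t hst ⟨C, hC⟩ => ⟨C, fun r hr => hC r (hst hr)⟩) ?_ ?_
    · rintro s t ⟨C, hC⟩ ⟨D, hD⟩
      refine ⟨max C D, ?_⟩
      rintro r (hr | hr)
      · exact (hC r hr).trans (by exact_mod_cast le_max_left _ _)
      · exact (hD r hr).trans (by exact_mod_cast le_max_right _ _)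
    · intro t ht
      have h1 : ∀ᶠ r in 𝓝[Set.Icc 0 T] t, sobolevSq 2 (η r - η t) < 1 :=
        ((h.cont t ht.1).mono_left (nhdsWithin_mono t hsub)).eventually_lt_const one_pos
      obtain ⟨M, hM⟩ := ENNReal.lt_iff_exists_nnreal_btwn.1 (h.mem t ht.1)
      refine ⟨_, h1, 2 * 1 + 2 * M, fun r hr => ?_⟩
      refine (sobolevSq_le_add (η r) (η t)).trans ?_
      push_cast
      exact add_le_add (mul_le_mul_right (le_of_lt hr) 2) (mul_le_mul_right hM.1.le 2)
  obtain ⟨C, hC⟩ := hbd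
  refine ⟨C, ⟨fun t _ ξ => modes_neg _ _, fun t ht => H2Le_of_sobolevSq_le C.2 ?_, ?_, ?_⟩⟩
  · rw [ENNReal.ofReal_coe_nnreal]; exact hC t ht
  · intro ξ t ht
    have h0 := (h.cont t ht.1).mono_left (nhdsWithin_mono t hsub)
    have hle : ∀ r, ENNReal.ofReal (‖modes (η r) ξ - modes (η t) ξ‖ ^ 2)
        ≤ sobolevSq 2 (η r - η t) := fun r => by
      rw [sobolevSq_eq]
      refine le_trans (ENNReal.ofReal_le_ofReal ?_) (ENNReal.le_tsum ξ)
      rw [modes_sub]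
      exact le_mul_of_one_le_left (sq_nonneg _) (one_le_pow₀ (one_le_wt ξ))
    have h1 := tendsto_of_tendsto_of_tendsto_of_le_of_le tendsto_const_nhds h0
      (fun r => bot_le) hle
    have h2 := (ENNReal.tendsto_toReal ENNReal.zero_ne_top).comp h1
    simp only [Function.comp_def, ENNReal.toReal_ofReal (sq_nonneg _), ENNReal.toReal_zero] at h2
    have h3 := h2.sqrt
    simp only [Real.sqrt_sq (norm_nonneg _), Real.sqrt_zero] at h3
    exact tendsto_iff_norm_sub_tendsto_zero.2 h3
  · intro ξ t ht
    have h1 := h.equation (expo (-ξ)) (isTest_expo _) t ht.1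
    rw [← h.initial] at h1
    simp only [← weakRHS_expo]
    rw [intervalIntegral.integral_const_mul, ← h1, modes, modes, coeff, coeff, ← mul_sub]
    simp only [mul_comm (expo _ _)]

/-- Exponential decay, up to a constant, of the distance to the background flow. -/
theorem IsModeFlow.tsum_sub_le {β δ ε T C D : ℝ} {a : ℝ → ℤ × ℤ → ℂ} {φ : ℤ × ℤ → ℂ}
    (h : IsModeFlow β δ ε T C a) (hφ : (Function.support φ).Finite) (hD : 0 ≤ D)
    (hdiss : ∀ t ∈ Set.Icc 0 T, ∑' ξ, 2 * inner ℝ (a t ξ - φ ξ) (rate β δ ε (a t) ξ)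
      ≤ -(1 / 2) * ∑' ξ, ‖a t ξ - φ ξ‖ ^ 2 + D) {t : ℝ} (ht : t ∈ Set.Icc 0 T) :
    ∑' ξ, ‖a t ξ - φ ξ‖ ^ 2
      ≤ (∑' ξ, ‖a 0 ξ - φ ξ‖ ^ 2) * Real.exp (-(1 / 2) * t) + 2 * D := by
  have hφC : H2Le (∑' ξ, wt ξ ^ 2 * ‖φ ξ‖ ^ 2) φ :=
    ⟨summable_of_hasFiniteSupport (hφ.subset fun ξ hξ h0 => hξ (by simp [h0])), le_rfl⟩
  set Cφ := ∑' ξ, wt ξ ^ 2 * ‖φ ξ‖ ^ 2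
  obtain ⟨C', hC'⟩ := exists_bound_pairing β δ ε (2 * (C + Cφ))
  have hb : ∀ t ∈ Set.Icc 0 T, H2Le (2 * (C + Cφ)) (fun ξ => a t ξ - φ ξ) := fun t ht =>
    (h.bound t ht).sub hφC
  have hgr := energy_gronwall (T := T) (C := C') (K := -(1 / 2)) (D := D)
    (b := fun t ξ => a t ξ - φ ξ) (n := fun t ξ => rate β δ ε (a t) ξ)
    (fun ξ => h.continuousOn_rate ξ)
    (fun ξ t ht => by rw [← h.duhamel ξ t ht]; ring)
    (fun t ht => ?_) (fun t ht => (hb t ht).summable_sq) hdiss ht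
  · rw [gronwallBound_of_K_ne_0 (by norm_num)] at hgr
    have := Real.exp_pos (-(1 / 2) * t)
    refine hgr.trans ?_
    beta_reduce
    have h2 : D / -(1 / 2) * (Real.exp (-(1 / 2) * t) - 1)
        = 2 * D - 2 * D * Real.exp (-(1 / 2) * t) := by ring
    rw [h2]
    nlinarith [mul_nonneg hD this.le]
  · have ha' : H2Le (2 * (C + Cφ)) (a t) :=
      (h.bound t ht).mono (by linarith [(h.bound t ht).nonneg, hφC.nonneg])
    exact hC' _ _ _ _ (hb t ht) ha' ha' ha'

/-! ### The absorbing ball -/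

/-- An absorbing ball of `L²`, with an entering time that depends only on the size of the datum. -/
theorem exists_absorbing_radius (β δ : ℝ) {ε : ℝ} (hε : 0 < ε) :
    ∃ R : ℝ, 0 < R ∧ ∀ M : ℝ, ∃ T : ℝ, 0 ≤ T ∧ ∀ (η₀ : L2) (η : ℝ → L2), OddInX η₀ →
      IsSolution β δ ε η₀ η → ‖η₀‖ ≤ M → ∀ t : ℝ, T ≤ t → ‖η t‖ ≤ R := by
  obtain ⟨φ, hfin, D, hD, hdiss⟩ := exists_background β δ hε
  have hφ2 : Summable (fun ξ => ‖φ ξ‖ ^ 2) :=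
    summable_of_hasFiniteSupport (hfin.subset fun ξ hξ h0 => hξ (by simp [h0]))
  set Q := ∑' ξ, ‖φ ξ‖ ^ 2 with hQ
  have hQ0 : 0 ≤ Q := tsum_nonneg fun _ => sq_nonneg _
  have hpi := Real.two_pi_pos
  set c := 2 * Real.pi with hc
  refine ⟨c * Real.sqrt (2 * (1 + 2 * D) + 2 * Q), by positivity, fun M => ?_⟩
  set B := 2 * (M / c) ^ 2 + 2 * Q with hB
  have hB0 : 0 ≤ B := by positivity
  refine ⟨2 * B, by positivity, fun η₀ η hodd hη hM t ht => ?_⟩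
  have ht0 : 0 ≤ t := (by positivity : 0 ≤ 2 * B).trans ht
  obtain ⟨C, hflow⟩ := hη.exists_isModeFlow t
  have hsym : ∀ r ∈ Set.Icc 0 t, ∀ ξ, modes (η r) (reflX ξ) = -modes (η r) ξ :=
    fun r hr ξ => hflow.odd hε (fun ξ => by rw [hη.initial, modes_reflX hodd]) hr ξ
  have hV := hflow.tsum_sub_le hfin hD
    (fun r hr => hdiss C _ (hflow.bound r hr) (hflow.real r hr) (hsym r hr)) ⟨ht0, le_rfl⟩
  -- Comparison of the distance to `φ` with the norm, at both ends of the time interval.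
  have hS : ∀ r ∈ Set.Icc 0 t, Summable (fun ξ => ‖modes (η r) ξ‖ ^ 2) := fun r hr =>
    (hflow.bound r hr).summable_sq
  have hle1 : ∀ r ξ, ‖modes (η r) ξ - φ ξ‖ ^ 2 ≤ 2 * ‖modes (η r) ξ‖ ^ 2 + 2 * ‖φ ξ‖ ^ 2 :=
    fun r ξ => by
      have := pow_le_pow_left₀ (norm_nonneg _) (norm_sub_le (modes (η r) ξ) (φ ξ)) 2
      nlinarith [sq_nonneg (‖modes (η r) ξ‖ - ‖φ ξ‖)]
  have hle2 : ∀ r ξ, ‖modes (η r) ξ‖ ^ 2 ≤ 2 * ‖modes (η r) ξ - φ ξ‖ ^ 2 + 2 * ‖φ ξ‖ ^ 2 :=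
    fun r ξ => by
      have h1 : ‖modes (η r) ξ‖ ≤ ‖modes (η r) ξ - φ ξ‖ + ‖φ ξ‖ := by
        simpa using norm_add_le (modes (η r) ξ - φ ξ) (φ ξ)
      have := pow_le_pow_left₀ (norm_nonneg _) h1 2
      nlinarith [sq_nonneg (‖modes (η r) ξ - φ ξ‖ - ‖φ ξ‖)]
  have hs1 : ∀ r ∈ Set.Icc 0 t,
      Summable (fun ξ => 2 * ‖modes (η r) ξ‖ ^ 2 + 2 * ‖φ ξ‖ ^ 2) := fun r hr =>
    ((hS r hr).mul_left 2).add (hφ2.mul_left 2)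
  have hsd : ∀ r ∈ Set.Icc 0 t, Summable (fun ξ => ‖modes (η r) ξ - φ ξ‖ ^ 2) := fun r hr =>
    (hs1 r hr).of_nonneg_of_le (fun _ => sq_nonneg _) (hle1 r)
  have h0m : (0 : ℝ) ∈ Set.Icc 0 t := ⟨le_rfl, ht0⟩
  have htm : t ∈ Set.Icc 0 t := ⟨ht0, le_rfl⟩
  have hV0 : ∑' ξ, ‖modes (η 0) ξ - φ ξ‖ ^ 2 ≤ B := by
    refine ((hsd 0 h0m).tsum_le_tsum (hle1 0) (hs1 0 h0m)).trans ?_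
    rw [((hS 0 h0m).mul_left 2).tsum_add (hφ2.mul_left 2), tsum_mul_left, tsum_mul_left]
    have h1 := norm_sq_eq_tsum_modes (η 0)
    have h2 : ‖η 0‖ ^ 2 ≤ M ^ 2 := by
      rw [hη.initial]; exact pow_le_pow_left₀ (norm_nonneg _) hM 2
    have h3 : ∑' ξ, ‖modes (η 0) ξ‖ ^ 2 ≤ (M / c) ^ 2 := by
      rw [div_pow, le_div_iff₀ (by positivity)]
      linarith
    linarith
  have hexp : B * Real.exp (-(1 / 2) * t) ≤ 1 := by
    have h1 : Real.exp (-(1 / 2) * t) ≤ Real.exp (-B) := Real.exp_le_exp.2 (by linarith)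
    have h2 : B ≤ Real.exp B := by linarith [Real.add_one_le_exp B]
    calc B * Real.exp (-(1 / 2) * t) ≤ Real.exp B * Real.exp (-B) := by gcongr
      _ = 1 := by rw [← Real.exp_add, add_neg_cancel, Real.exp_zero]
  have hVt : ∑' ξ, ‖modes (η t) ξ - φ ξ‖ ^ 2 ≤ 1 + 2 * D := by
    have := mul_le_mul_of_nonneg_right hV0 (Real.exp_pos (-(1 / 2) * t)).le
    linarith
  have hSt : ∑' ξ, ‖modes (η t) ξ‖ ^ 2 ≤ 2 * (1 + 2 * D) + 2 * Q := by
    have hs2 := ((hsd t htm).mul_left 2).add (hφ2.mul_left 2)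
    refine ((hS t htm).tsum_le_tsum (hle2 t) hs2).trans ?_
    rw [((hsd t htm).mul_left 2).tsum_add (hφ2.mul_left 2), tsum_mul_left, tsum_mul_left]
    linarith
  refine (pow_le_pow_iff_left₀ (norm_nonneg _) (by positivity) two_ne_zero).1 ?_
  rw [norm_sq_eq_tsum_modes, mul_pow c, Real.sq_sqrt (by positivity)]
  gcongr

end FallingFilm

end

theorem mainTheorem2 (β δ ε : ℝ) (hβ : 0 < β) (hδ : 0 ≤ δ) (hε : 0 < ε) :
    ∃ R : ℝ, 0 < R ∧
      (∀ (η₀ : FallingFilm.L2) (η : ℝ → FallingFilm.L2),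
        FallingFilm.MemSobolev 2 η₀ → FallingFilm.OddInX η₀ →
        FallingFilm.IsSolution β δ ε η₀ η →
          limsup (fun t : ℝ => ‖η t‖ₑ) atTop ≤ ENNReal.ofReal R) ∧
      (∀ M : ℝ, ∃ T : ℝ, 0 ≤ T ∧
        ∀ (η₀ : FallingFilm.L2) (η : ℝ → FallingFilm.L2),
          FallingFilm.MemSobolev 2 η₀ → FallingFilm.OddInX η₀ →
          FallingFilm.IsSolution β δ ε η₀ η →
          ‖η₀‖ ≤ M → ∀ t : ℝ, T ≤ t → ‖η t‖ ≤ R) := by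
  obtain ⟨R, hR, habs⟩ := FallingFilm.exists_absorbing_radius β δ hε
  refine ⟨R, hR, fun η₀ η _ hodd hη => ?_, fun M => ?_⟩
  · obtain ⟨T, _, hT⟩ := habs ‖η₀‖
    refine limsup_le_of_le ?_ ?_
    · isBoundedDefault
    · filter_upwards [eventually_ge_atTop T] with t ht
      rw [← ofReal_norm]
      exact ENNReal.ofReal_le_ofReal (hT η₀ η hodd hη le_rfl t ht)
  · obtain ⟨T, hT0, hT⟩ := habs M
    exact ⟨T, hT0, fun η₀ η _ hodd hη hM t ht => hT η₀ η hodd hη hM t ht⟩
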